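/- Let $\mathbf H_6\subset \mathrm{PSL}_2(\mathbb R)$ be the Hecke group generated by $S=\begin{pmatrix}0&-1\\1&0\end{pmatrix}$ and $T=\begin{pmatrix}1&\lambda\\0&1\end{pmatrix}$ with $\lambda=2\cos\frac{\pi}{6}=\sqrt3$, acting on $\mathbb R\cup\{\infty\}$ by linear fractional transformations, and let $\mathbb Q(\mathbf H_6)\subset\mathbb R\cup\{\infty\}$ be the set of points fixed by parabolic elements of $\mathbf H_6$. For $g\in\mathbf H_6$ write $a(g),c(g)$ for the entries of the first column of a matrix representing $g$ (determined up to a common sign), so that $g(\infty)=a(g)/c(g)$. For $\xi\in\mathbb R\setminus\mathbb Q(\mathbf H_6)$ let $$L(\xi)=\limsup_{g\in\mathbf H_6}\bigl(c(g)^2\,|\xi-g(\infty)|\bigr)^{-1}\in[0,\infty],$$ where the limit superior is taken over distinct points $g(\infty)$ (elements with $g(\infty)=\infty$ being disregarded), that is, $L(\xi)$ is the infimum of all $h \in [0,\infty]$ such that $(c(g)^2|\xi-g(\infty)|)^{-1}\le h$ for all such $g$ but those with $g(\infty)$ in some finite set. The Lagrange spectrum is $\mathscr L(\mathbf H_6)=\{L(\xi)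 : \xi\in\mathbb R\setminus\mathbb Q(\mathbf H_6)\}$. For a real binary quadratic form $f(x,y)=\alpha x^2+\beta xy+\gamma y^2$ with discriminant $\Delta(f)=\beta^2-4\alpha\gamma>0$ let $$m(f)=\sup_{g\in\mathbf H_6}\frac{\sqrt{\Delta(f)}}{|f(a(g),c(g))|}\in[0,\infty]$$ (a term with denominator $0$ being $\infty$). The Markoff spectrum is $\mathscr M(\mathbf H_6)=\{m(f) : \Delta(f)>0\}$. **Theorem.** For every $\varepsilon>0$, $$\dim_H\left(\mathscr M(\mathbf H_6)\cap\left[0,\tfrac{4}{\sqrt3}+\varepsilon\right)\right)\ \ge\ \dim_H\left(\mathscr L(\mathbf H_6)\cap\left[0,\tfrac{4}{\sqrt3}+\varepsilon\right)\right)\ >\ 0,$$ where $\dim_H$ denotes the Hausdorff dimension. -/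

import Mathlib

open scoped MatrixGroups ENNReal

namespace HeckeSpectra

noncomputable section

/-- The preimage in `SL(2, ℝ)` of a subgroup `G` of `PSL(2, ℝ)`: all matrices representing
elements of `G` (two for each element, differing by a sign). All quantities below are
insensitive to that sign. -/
def matrices (G : Subgroup PSL(2, ℝ)) : Subgroup SL(2, ℝ) :=
  G.comap (QuotientGroup.mk' (Subgroup.center SL(2, ℝ)))

/-- `S = [[0, -1], [1, 0]]`. -/
def matS : SL(2, ℝ) := ⟨!![0, -1; 1, 0], by simp [Matrix.det_fin_two]⟩

/-- `T = [[1, l], [0, 1]]`. -/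
def matT (l : ℝ) : SL(2, ℝ) := ⟨!![1, l; 0, 1], by simp [Matrix.det_fin_two]⟩

/-- `λ_q = 2 cos (π / q)`. -/
def heckeLambda (q : ℕ) : ℝ := 2 * Real.cos (Real.pi / q)

/-- The Hecke group `H_q`: the subgroup of `PSL(2, ℝ)` generated by (the classes of) `S` and
`T = [[1, λ_q], [0, 1]]`. -/
def heckeGroup (q : ℕ) : Subgroup PSL(2, ℝ) :=
  Subgroup.closure {((matS : SL(2, ℝ)) : PSL(2, ℝ)), ((matT (heckeLambda q) : SL(2, ℝ)) : PSL(2, ℝ))}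

/-- `Q(G)`, the set of points of `ℝ ∪ {∞}` fixed by some parabolic element of `G`. -/
def parabolicPoints (G : Subgroup PSL(2, ℝ)) : Set (OnePoint ℝ) :=
  {x | IsCusp x ((matrices G).map Matrix.SpecialLinearGroup.toGL)}

/-- `g(∞) ∈ ℝ ∪ {∞}`. -/
def imageOfInfty (g : SL(2, ℝ)) : OnePoint ℝ :=
  Matrix.SpecialLinearGroup.toGL g • (OnePoint.infty : OnePoint ℝ)

/-- The Lagrange number `L_G(ξ) = limsup (c(g)² |ξ - g(∞)|)⁻¹ ∈ [0, ∞]`, where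
`g(∞) = a(g) / c(g)`. The quantity depends on `g` only through the point `g(∞)`, and the limit
superior is over infinitely many distinct points `g(∞)`: a property holds eventually if it holds
for all `g ∈ G` outside finitely many values of `g(∞)`. In particular the elements with
`c(g) = 0`, all of which have `g(∞) = ∞`, play no role. -/
def lagrangeNumber (G : Subgroup PSL(2, ℝ)) (ξ : ℝ) : ℝ≥0∞ :=
  Filter.limsup
    (fun g : matrices G =>
      (ENNReal.ofReal (g.1 1 0 ^ 2 * |ξ - g.1 0 0 / g.1 1 0|))⁻¹)
    (Filter.comap (fun g : matrices G => imageOfInfty g.1) Filter.cofinite)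

/-- The Lagrange spectrum of `G`, a subset of `[0, ∞]`. -/
def lagrangeSpectrum (G : Subgroup PSL(2, ℝ)) : Set ℝ≥0∞ :=
  {L | ∃ ξ : ℝ, (ξ : OnePoint ℝ) ∉ parabolicPoints G ∧ lagrangeNumber G ξ = L}

/-- For the form `f(x, y) = α x² + β x y + γ y²`, the number
`m_G(f) = sup_{g ∈ G} √Δ(f) / |f(a(g), c(g))| ∈ [0, ∞]`, with `Δ(f) = β² - 4αγ`.
If `Δ(f) > 0` and `f(a(g), c(g)) = 0` for some `g`, then it is `∞`. -/
def markoffNumber (G : Subgroup PSL(2, ℝ)) (α β γ : ℝ) : ℝ≥0∞ :=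
  ⨆ g : matrices G,
    ENNReal.ofReal (Real.sqrt (β ^ 2 - 4 * α * γ)) /
      ENNReal.ofReal |α * g.1 0 0 ^ 2 + β * g.1 0 0 * g.1 1 0 + γ * g.1 1 0 ^ 2|

/-- The Markoff spectrum of `G`, a subset of `[0, ∞]`. -/
def markoffSpectrum (G : Subgroup PSL(2, ℝ)) : Set ℝ≥0∞ :=
  {m | ∃ α β γ : ℝ, 0 < β ^ 2 - 4 * α * γ ∧ markoffNumber G α β γ = m}

/-- The part `A ∩ [0, t)` of a set `A ⊆ [0, ∞]`, as a set of real numbers. -/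
def partBelow (A : Set ℝ≥0∞) (t : ℝ) : Set ℝ :=
  {x : ℝ | 0 ≤ x ∧ x < t ∧ ENNReal.ofReal x ∈ A}

end

end HeckeSpectra

/-!
# Positive dimension of the Lagrange spectrum of `H_6` just above `4 / √3`

**Lagrange numbers are Markoff numbers.** For `f(x, y) = y (x - ξ y)` and `g` in `H_6` one has
`f(a(g), c(g)) = c(g)² (a(g) / c(g) - ξ)`, so that the Lagrange number `L(ξ)` is the limit superior
of the inverses of the first coefficients of the forms `f ∘ g`, all of discriminant `1`. Along
elements `g` that realise a finite positive limit superior, the forms `f ∘ g` become bounded once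
`g` is multiplied by a suitable power of `T`, hence accumulate at a form whose Markoff number is
`L(ξ)`; this is `mem_markoffSpectrum_of_lagrangeNumber`. So the first inequality holds, the number
`0` being irrelevant for the dimension.

**Expansions.** The group `H_6` preserves a tessellation by ideal hexagons. A geodesic that crosses
it is coded by its turns; for the geodesics used here these are the digits `2, 3, 4`, Möbius maps
that contract `[0, ∞)`. If the edge `[0, ∞]` is crossed by a geodesic from `-1 / ρ` to `ξ`, the
cusps `∞` and `0` see it with width `ξ + 1 / ρ` and `ρ + 1 / ξ`. Cusps which are not ends of crossed
edges see a width at most `2`, because the matrices of `H_6` have integral entries up to factors `√3`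
(`Digit.descend`). Hence `L(ξ)` is the limit superior of the widths at the crossed edges
(`IsExpansion.lagrangeNumber_eq`).

**The accumulation point.** The geodesic with digits `… 2 4 2 4 3 4 2 4 2 …` has width exactly
`4 / √3` at the digit `3`. For a sequence of digits `(4, 2)^{e 0}, 3, (4, 2)^{e 1}, 3, …` with all
exponents at least `n` the widths are at most `4 / √3 + 4 / 3 ^ n`. At a digit `3` the width is
`height p q`, which increases with the future `p` and decreases with the reversed past `q`, and both
are lexicographically increasing in the exponents. Let the exponent be `n` just before each
square index and `n + 3` at the square, and let all others be `n + 1` or `n + 2`. Then the largest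
widths are those at the squares. If moreover longer and longer initial segments of a sequence `b` of
bits are coded after the squares, and the exponents before the squares are `n + 1` over longer and
longer ranges, the limit superior is `codedHeight n b`, in which only the future depends on `b`.

**Dimension.** If `k` is the first place where `b` and `b'` differ, then `codedHeight n b` and
`codedHeight n b'` are at distance at least `c r ^ k`, with `c` and `r` depending only on `n`.
Reading `b` as a binary expansion is therefore a Hölder map from the set of these numbers onto
`[0, 1]`, and the set has positive dimension (`dimH_range_pos`).
-/

open scoped MatrixGroups ENNReal

namespace HeckeSpectra

/-! ### Matrices representing the elements of `H_6` -/

/-- The set of matrices in `SL(2, ℝ)` of one of the two shapes `[[a, √3 b], [√3 c, d]]` and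
`[[√3 a, b], [c, √3 d]]` with integers `a, b, c, d`. It is a group, and it contains every matrix
representing an element of `H_6`. -/
noncomputable def integralMatrices : Subgroup SL(2, ℝ) where
  carrier := {g | (∃ a b c d : ℤ, g 0 0 = a ∧ g 0 1 = √3 * b ∧ g 1 0 = √3 * c ∧ g 1 1 = d) ∨
    (∃ a b c d : ℤ, g 0 0 = √3 * a ∧ g 0 1 = b ∧ g 1 0 = c ∧ g 1 1 = √3 * d)}
  one_mem' := Or.inl ⟨1, 0, 0, 1, by simp⟩
  mul_mem' := by
    have h3 : √3 * √3 = (3 : ℝ) := Real.mul_self_sqrt (by norm_num)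
    rintro g h (⟨a, b, c, d, h1, h2, h3', h4⟩ | ⟨a, b, c, d, h1, h2, h3', h4⟩)
      (⟨a', b', c', d', k1, k2, k3, k4⟩ | ⟨a', b', c', d', k1, k2, k3, k4⟩)
    · refine Or.inl ⟨a * a' + 3 * b * c', a * b' + b * d', c * a' + d * c', 3 * c * b' + d * d',
        ?_, ?_, ?_, ?_⟩ <;>
      simp only [Matrix.SpecialLinearGroup.coe_mul, Matrix.mul_apply, Fin.sum_univ_two, h1, h2,
        h3', h4, k1, k2, k3, k4] <;> push_cast <;> grind
    · refine Or.inr ⟨a * a' + b * c', a * b' + 3 * b * d', 3 * c * a' + d * c', c * b' + d * d',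
        ?_, ?_, ?_, ?_⟩ <;>
      simp only [Matrix.SpecialLinearGroup.coe_mul, Matrix.mul_apply, Fin.sum_univ_two, h1, h2,
        h3', h4, k1, k2, k3, k4] <;> push_cast <;> grind
    · refine Or.inr ⟨a * a' + b * c', 3 * a * b' + b * d', c * a' + 3 * d * c', c * b' + d * d',
        ?_, ?_, ?_, ?_⟩ <;>
      simp only [Matrix.SpecialLinearGroup.coe_mul, Matrix.mul_apply, Fin.sum_univ_two, h1, h2,
        h3', h4, k1, k2, k3, k4] <;> push_cast <;> grind
    · refine Or.inl ⟨3 * a * a' + b * c', a * b' + b * d', c * a' + d * c', c * b' + 3 * d * d',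
        ?_, ?_, ?_, ?_⟩ <;>
      simp only [Matrix.SpecialLinearGroup.coe_mul, Matrix.mul_apply, Fin.sum_univ_two, h1, h2,
        h3', h4, k1, k2, k3, k4] <;> push_cast <;> grind
  inv_mem' := by
    rintro g (⟨a, b, c, d, h1, h2, h3', h4⟩ | ⟨a, b, c, d, h1, h2, h3', h4⟩)
    · refine Or.inl ⟨d, -b, -c, a, ?_, ?_, ?_, ?_⟩ <;>
      simp [Matrix.SpecialLinearGroup.SL2_inv_expl, h1, h2, h3', h4]
    · refine Or.inr ⟨d, -b, -c, a, ?_, ?_, ?_, ?_⟩ <;>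
      simp [Matrix.SpecialLinearGroup.SL2_inv_expl, h1, h2, h3', h4]

lemma mul_entry (g h : SL(2, ℝ)) (i j : Fin 2) :
    (g * h) i j = g i 0 * h 0 j + g i 1 * h 1 j := by
  rw [Matrix.SpecialLinearGroup.coe_mul, Matrix.mul_apply, Fin.sum_univ_two]

lemma neg_entry (g : SL(2, ℝ)) (i j : Fin 2) : (-g) i j = -g i j := rfl

lemma inv_entries (g : SL(2, ℝ)) : (g⁻¹ : SL(2, ℝ)) 0 0 = g 1 1 ∧ (g⁻¹ : SL(2, ℝ)) 0 1 = -g 0 1 ∧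
    (g⁻¹ : SL(2, ℝ)) 1 0 = -g 1 0 ∧ (g⁻¹ : SL(2, ℝ)) 1 1 = g 0 0 := by
  simp [Matrix.SpecialLinearGroup.SL2_inv_expl]

@[simp] lemma matT_zero_zero (l : ℝ) : matT l 0 0 = 1 := rfl
@[simp] lemma matT_zero_one (l : ℝ) : matT l 0 1 = l := rfl
@[simp] lemma matT_one_zero (l : ℝ) : matT l 1 0 = 0 := rfl
@[simp] lemma matT_one_one (l : ℝ) : matT l 1 1 = 1 := rfl

lemma heckeLambda_six : heckeLambda 6 = √3 := by
  simp only [heckeLambda, Nat.cast_ofNat, Real.cos_pi_div_six]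
  ring

lemma center_le_integralMatrices : Subgroup.center SL(2, ℝ) ≤ integralMatrices := by
  intro g hg
  rw [Matrix.SpecialLinearGroup.mem_center_iff] at hg
  obtain ⟨r, hr, h⟩ := hg
  have hr' : r = 1 ∨ r = -1 := by simpa using hr
  have key : ∀ i j, g.1 i j = Matrix.scalar (Fin 2) r i j := fun i j => by rw [h]
  rcases hr' with rfl | rfl
  · exact Or.inl ⟨1, 0, 0, 1, by simp [key]⟩
  · exact Or.inl ⟨-1, 0, 0, -1, by simp [key]⟩

lemma matrices_le_integralMatrices : matrices (heckeGroup 6) ≤ integralMatrices := by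
  have h : heckeGroup 6 ≤
      integralMatrices.map (QuotientGroup.mk' (Subgroup.center SL(2, ℝ))) := by
    rw [heckeGroup, Subgroup.closure_le]
    rintro x (rfl | rfl)
    · exact ⟨matS, Or.inr ⟨0, -1, 1, 0, by simp [matS]⟩, rfl⟩
    · exact ⟨matT (heckeLambda 6), Or.inl ⟨1, 1, 0, 1, by simp [matT, heckeLambda_six]⟩, rfl⟩
  calc matrices (heckeGroup 6) ≤ _ := Subgroup.comap_mono h
    _ = integralMatrices := Subgroup.comap_map_eq_self (by
        rw [QuotientGroup.ker_mk']; exact center_le_integralMatrices)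

lemma matS_mem : matS ∈ matrices (heckeGroup 6) :=
  Subgroup.subset_closure (Or.inl rfl)

lemma matT_mem : matT √3 ∈ matrices (heckeGroup 6) := by
  rw [← heckeLambda_six]
  exact Subgroup.subset_closure (Or.inr rfl)

lemma matT_zpow (l : ℝ) (k : ℤ) : (matT l) ^ k = matT (l * k) := by
  have hadd : ∀ a b : ℝ, matT a * matT b = matT (a + b) := by
    intro a b
    ext i j
    rw [mul_entry]
    fin_cases i <;> fin_cases j <;> simp [add_comm]
  have h0 : matT 0 = 1 := by
    ext i j
    fin_cases i <;> fin_cases j <;> simp [matT]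
  induction k using Int.induction_on with
  | zero => simp [h0]
  | succ n ih => rw [zpow_add_one, ih, hadd]; congr 1; push_cast; ring
  | pred n ih =>
    rw [zpow_sub_one, ih, mul_inv_eq_iff_eq_mul, hadd]; congr 1; push_cast; ring

lemma matT_mul_int_mem (k : ℤ) : matT (√3 * k) ∈ matrices (heckeGroup 6) := by
  rw [← matT_zpow]
  exact Subgroup.zpow_mem _ matT_mem k

lemma imageOfInfty_eq (g : SL(2, ℝ)) :
    imageOfInfty g = if g 1 0 = 0 then OnePoint.infty else ((g 0 0 / g 1 0 : ℝ) : OnePoint ℝ) := by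
  rw [imageOfInfty, OnePoint.smul_infty_eq_ite]
  congr

lemma imageOfInfty_neg (g : SL(2, ℝ)) : imageOfInfty (-g) = imageOfInfty g := by
  simp [imageOfInfty_eq]

lemma imageOfInfty_mul_matT (g : SL(2, ℝ)) (l : ℝ) :
    imageOfInfty (g * matT l) = imageOfInfty g := by
  simp [imageOfInfty_eq, mul_entry]

lemma det_eq_one (g : SL(2, ℝ)) : g 0 0 * g 1 1 - g 0 1 * g 1 0 = 1 := by
  have := g.2
  rwa [Matrix.det_fin_two] at this

/-- The stabiliser of `∞` in `H_6` is generated by `T`. -/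
lemma eq_mul_matT_of_imageOfInfty_eq {g u : SL(2, ℝ)} (hg : g ∈ matrices (heckeGroup 6))
    (hu : u ∈ matrices (heckeGroup 6)) (h : imageOfInfty g = imageOfInfty u) :
    ∃ k : ℤ, g = u * matT (√3 * k) ∨ g = -(u * matT (√3 * k)) := by
  have h3 : √3 * √3 = (3 : ℝ) := Real.mul_self_sqrt (by norm_num)
  have hmem := matrices_le_integralMatrices (mul_mem (inv_mem hu) hg)
  set t := u⁻¹ * g with ht
  have ht0 : t 1 0 = 0 := by
    rw [ht, mul_entry, (inv_entries u).2.2.1, (inv_entries u).2.2.2]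
    rw [imageOfInfty_eq, imageOfInfty_eq] at h
    split_ifs at h with h1 h2 h2
    · simp [h1, h2]
    · exact absurd h.symm (OnePoint.coe_ne_infty _)
    · exact absurd h (OnePoint.coe_ne_infty _)
    · rw [OnePoint.coe_eq_coe, div_eq_div_iff h1 h2] at h
      linarith
  have hgu : g = u * t := by simp [ht]
  have hdet := det_eq_one t
  rw [ht0, mul_zero, sub_zero] at hdet
  rcases hmem with ⟨a, b, c, d, h1, h2, h3', h4⟩ | ⟨a, b, c, d, h1, h2, h3', h4⟩
  · rw [h1, h4] at hdet
    have had : a * d = 1 := by exact_mod_cast hdet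
    rcases Int.eq_one_or_neg_one_of_mul_eq_one' had with ⟨rfl, rfl⟩ | ⟨rfl, rfl⟩
    · refine ⟨b, Or.inl ?_⟩
      rw [hgu]; congr 1
      ext i j
      fin_cases i <;> fin_cases j <;> simp [matT, h1, h2, h4, ht0]
    · refine ⟨-b, Or.inr ?_⟩
      rw [hgu, ← mul_neg]; congr 1
      ext i j
      fin_cases i <;> fin_cases j <;> simp [neg_entry, h1, h2, h4, ht0]
  · rw [h1, h4] at hdet
    have had : 3 * (a * d) = 1 := by
      have : (3 * (a * d) : ℝ) = 1 := by rw [← hdet]; linear_combination (-(a * d : ℝ)) * h3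
      exact_mod_cast this
    omega

/-! ### Lagrange numbers are Markoff numbers -/

/-- The three coefficients of the form `f ∘ g`, where `f(x, y) = y (x - ξ y)`. This is the first
one, `f(a(g), c(g))`. -/
noncomputable def formA (ξ : ℝ) (g : SL(2, ℝ)) : ℝ := g 1 0 * (g 0 0 - ξ * g 1 0)

/-- The middle coefficient of `f ∘ g`, where `f(x, y) = y (x - ξ y)`. -/
noncomputable def formB (ξ : ℝ) (g : SL(2, ℝ)) : ℝ :=
  g 1 0 * (g 0 1 - ξ * g 1 1) + g 1 1 * (g 0 0 - ξ * g 1 0)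

/-- The last coefficient of `f ∘ g`, where `f(x, y) = y (x - ξ y)`. -/
noncomputable def formC (ξ : ℝ) (g : SL(2, ℝ)) : ℝ := g 1 1 * (g 0 1 - ξ * g 1 1)

lemma form_discrim (ξ : ℝ) (g : SL(2, ℝ)) : formB ξ g ^ 2 - 4 * formA ξ g * formC ξ g = 1 := by
  have h := det_eq_one g
  have : formB ξ g ^ 2 - 4 * formA ξ g * formC ξ g = (g 0 0 * g 1 1 - g 0 1 * g 1 0) ^ 2 := by
    simp only [formA, formB, formC]; ring
  rw [this, h, one_pow]

lemma formA_mul (ξ : ℝ) (g h : SL(2, ℝ)) : formA ξ (g * h) =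
    formA ξ g * h 0 0 ^ 2 + formB ξ g * h 0 0 * h 1 0 + formC ξ g * h 1 0 ^ 2 := by
  simp only [formA, formB, formC, mul_entry]; ring

lemma formB_mul (ξ : ℝ) (g h : SL(2, ℝ)) : formB ξ (g * h) =
    2 * formA ξ g * h 0 0 * h 0 1 + formB ξ g * (h 0 0 * h 1 1 + h 0 1 * h 1 0) +
      2 * formC ξ g * h 1 0 * h 1 1 := by
  simp only [formA, formB, formC, mul_entry]; ring

lemma formC_mul (ξ : ℝ) (g h : SL(2, ℝ)) : formC ξ (g * h) =
    formA ξ g * h 0 1 ^ 2 + formB ξ g * h 0 1 * h 1 1 + formC ξ g * h 1 1 ^ 2 := by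
  simp only [formA, formB, formC, mul_entry]; ring

lemma formB_neg (ξ : ℝ) (g : SL(2, ℝ)) : formB ξ (-g) = formB ξ g := by
  simp only [formB, neg_entry]; ring

lemma formC_neg (ξ : ℝ) (g : SL(2, ℝ)) : formC ξ (-g) = formC ξ g := by
  simp only [formC, neg_entry]; ring

lemma sq_mul_abs_sub_div (ξ a c : ℝ) : c ^ 2 * |ξ - a / c| = |c * (a - ξ * c)| := by
  rcases eq_or_ne c 0 with h | h
  · simp [h]
  · rw [← abs_of_nonneg (sq_nonneg c), ← abs_mul, ← abs_neg]
    congr 1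
    field_simp
    ring

lemma lagrangeNumber_eq (G : Subgroup PSL(2, ℝ)) (ξ : ℝ) :
    lagrangeNumber G ξ = Filter.limsup (fun g : matrices G => (ENNReal.ofReal |formA ξ g.1|)⁻¹)
      (Filter.comap (fun g : matrices G => imageOfInfty g.1) Filter.cofinite) := by
  simp only [lagrangeNumber, sq_mul_abs_sub_div, formA]

/-- Translating by a power of `T` makes the middle coefficient of `f ∘ g` at most `√3 |α|`, `α`
being the first one. -/
lemma exists_abs_formB_le (ξ : ℝ) (g : SL(2, ℝ)) (h : formA ξ g ≠ 0) :
    ∃ k : ℤ, |formB ξ (g * matT (√3 * k))| ≤ √3 * |formA ξ g| := by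
  have h3 : (0 : ℝ) < √3 := by positivity
  set y := -formB ξ g / (2 * √3 * formA ξ g) with hy
  refine ⟨round y, ?_⟩
  have h1 : formB ξ (g * matT (√3 * round y)) = 2 * √3 * formA ξ g * (round y - y) := by
    rw [formB_mul, hy, mul_sub, mul_div_cancel₀ _ (by positivity)]
    simp
    ring
  have h2 : |(round y : ℝ) - y| ≤ 1 / 2 := by
    rw [abs_sub_comm]; exact abs_sub_round y
  rw [h1, abs_mul, abs_mul, abs_of_pos (by positivity : (0 : ℝ) < 2 * √3)]
  nlinarith [mul_nonneg h3.le (abs_nonneg (formA ξ g))]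

lemma exists_ultrafilter_tendsto_limsup {α : Type*} {F : Filter α} {u : α → ℝ≥0∞} {x : ℝ≥0∞}
    (h : Filter.limsup u F = x) (hx0 : x ≠ 0) (hxt : x ≠ ⊤) :
    ∃ U : Ultrafilter α, ↑U ≤ F ∧ Filter.Tendsto u U (nhds x) := by
  rw [← mapClusterPt_iff_ultrafilter, mapClusterPt_iff_frequently]
  intro s hs
  rw [mem_nhds_iff_exists_Ioo_subset' ⟨0, pos_iff_ne_zero.mpr hx0⟩ ⟨⊤, lt_top_iff_ne_top.mpr hxt⟩]
    at hs
  obtain ⟨l, r, ⟨hl, hr⟩, hs⟩ := hs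
  have h1 : ∃ᶠ a in F, l < u a := Filter.frequently_lt_of_lt_limsup (h := by rwa [h])
  have h2 : ∀ᶠ a in F, u a < r := Filter.eventually_lt_of_limsup_lt (by rwa [h])
  exact (h1.and_eventually h2).mono fun a ha => hs ha

lemma exists_tendsto_ultrafilter {α : Type*} (U : Ultrafilter α) {f : α → ℝ} {R : ℝ}
    (h : ∀ᶠ a in (U : Filter α), |f a| ≤ R) : ∃ y, Filter.Tendsto f U (nhds y) := by
  obtain ⟨y, -, hy⟩ := (isCompact_Icc (a := -R) (b := R)).ultrafilter_le_nhds' (U.map f)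
    (Filter.mem_map.mpr (h.mono fun a ha => abs_le.mp ha))
  exact ⟨y, hy⟩

/-- A form of discriminant `1` determines a bounded set of translations by powers of `T` that keep
its last two coefficients bounded. -/
lemma abs_int_le_of_translate {A B C R : ℝ} (hd : B ^ 2 - 4 * A * C = 1) :
    ∃ N : ℕ, ∀ k : ℤ, |2 * A * (√3 * k) + B| ≤ R →
      |A * (√3 * k) ^ 2 + B * (√3 * k) + C| ≤ R → |k| ≤ N := by
  have h3 : (1 : ℝ) ≤ √3 := by rw [Real.one_le_sqrt]; norm_num
  have key : ∀ (a b : ℝ) (k : ℤ), a ≠ 0 → |a * (√3 * k) + b| ≤ R →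
      |k| ≤ ((⌈(R + |b|) / |a|⌉₊ : ℕ) : ℤ) := by
    intro a b k ha h
    have h1 : |a| * |(k : ℝ)| ≤ R + |b| := by
      have h4 : |a * (√3 * k)| ≤ R + |b| := by
        have := abs_sub (a * (√3 * k) + b) b
        rw [add_sub_cancel_right] at this
        linarith
      rw [abs_mul, abs_mul, abs_of_pos (by positivity : (0 : ℝ) < √3)] at h4
      have : |a| * |(k : ℝ)| ≤ |a| * (√3 * |(k : ℝ)|) := by
        gcongr
        nlinarith [abs_nonneg (k : ℝ)]
      linarith
    have h2 : |(k : ℝ)| ≤ (R + |b|) / |a| := by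
      rw [le_div_iff₀ (abs_pos.mpr ha)]; linarith
    have h5 := h2.trans (Nat.le_ceil _)
    exact_mod_cast h5
  rcases eq_or_ne A 0 with rfl | hA
  · have hB : B ≠ 0 := by rintro rfl; norm_num at hd
    exact ⟨_, fun k _ h => key B C k hB (by simpa using h)⟩
  · exact ⟨_, fun k h _ => key (2 * A) B k (by simpa using hA) h⟩

/-- Every positive finite Lagrange number is a Markoff number: the forms `f ∘ g`, for
`f(x, y) = y (x - ξ y)` and `g` along an ultrafilter that realises the limit superior, converge
after normalisation by powers of `T`, and the limit form has the required Markoff number. -/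
lemma mem_markoffSpectrum_of_lagrangeNumber {ξ x : ℝ} (hx : 0 < x)
    (h : lagrangeNumber (heckeGroup 6) ξ = ENNReal.ofReal x) :
    ENNReal.ofReal x ∈ markoffSpectrum (heckeGroup 6) := by
  rw [lagrangeNumber_eq] at h
  obtain ⟨U, hUF, hU⟩ := exists_ultrafilter_tendsto_limsup h (by simpa using hx)
    ENNReal.ofReal_ne_top
  have hcof : Filter.Tendsto (fun g : matrices (heckeGroup 6) => imageOfInfty g.1) U
      Filter.cofinite := Filter.tendsto_iff_comap.mpr hUF
  have hA : Filter.Tendsto (fun g : matrices (heckeGroup 6) => |formA ξ g.1|) U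
      (nhds x⁻¹) := by
    have h1 := (ENNReal.tendsto_toReal (a := (ENNReal.ofReal x)⁻¹) (by simpa using hx)).comp
      ((continuous_inv.tendsto _).comp hU)
    simpa [Function.comp_def, ENNReal.toReal_ofReal, hx.le] using h1
  have hk : ∀ g : matrices (heckeGroup 6), ∃ k : ℤ, formA ξ g.1 ≠ 0 →
      |formB ξ (g.1 * matT (√3 * k))| ≤ √3 * |formA ξ g.1| := by
    intro g
    by_cases h0 : formA ξ g.1 = 0
    · exact ⟨0, fun h => absurd h0 h⟩
    · obtain ⟨k, hk⟩ := exists_abs_formB_le ξ g.1 h0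
      exact ⟨k, fun _ => hk⟩
  choose k hk using hk
  set t : matrices (heckeGroup 6) → SL(2, ℝ) := fun g => g.1 * matT (√3 * k g) with ht
  have htmem : ∀ g, t g ∈ matrices (heckeGroup 6) := fun g => mul_mem g.2 (matT_mul_int_mem _)
  have htA : ∀ g, formA ξ (t g) = formA ξ g.1 := by
    intro g
    rw [ht, formA_mul]; simp
  have hev : ∀ᶠ g in (U : Filter (matrices (heckeGroup 6))),
      |formA ξ g.1| ∈ Set.Ioo (x⁻¹ / 2) (2 * x⁻¹) :=
    hA (Ioo_mem_nhds (by have := inv_pos.mpr hx; linarith) (by have := inv_pos.mpr hx; linarith))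
  have hx' := inv_pos.mpr hx
  have hbA : ∀ᶠ g in (U : Filter (matrices (heckeGroup 6))), |formA ξ (t g)| ≤ 2 * x⁻¹ := by
    filter_upwards [hev] with g hg
    rw [htA]; exact hg.2.le
  have hbB : ∀ᶠ g in (U : Filter (matrices (heckeGroup 6))),
      |formB ξ (t g)| ≤ √3 * (2 * x⁻¹) := by
    filter_upwards [hev] with g hg
    refine (hk g (abs_pos.mp (by linarith [hg.1]))).trans ?_
    gcongr
    exact hg.2.le
  have hbC : ∀ᶠ g in (U : Filter (matrices (heckeGroup 6))),
      |formC ξ (t g)| ≤ ((√3 * (2 * x⁻¹)) ^ 2 + 1) / (2 * x⁻¹) := by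
    filter_upwards [hev, hbB] with g hg hB
    have hd := form_discrim ξ (t g)
    rw [le_div_iff₀ (by positivity)]
    have h1 : 4 * |formA ξ (t g)| * |formC ξ (t g)| = |formB ξ (t g) ^ 2 - 1| := by
      rw [show formB ξ (t g) ^ 2 - 1 = 4 * formA ξ (t g) * formC ξ (t g) by linarith, abs_mul,
        abs_mul]
      norm_num
    have h2 : |formB ξ (t g) ^ 2 - 1| ≤ (√3 * (2 * x⁻¹)) ^ 2 + 1 := by
      refine (abs_sub _ _).trans ?_
      rw [abs_one, abs_pow]
      gcongr
    rw [htA] at h1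
    nlinarith [hg.1, abs_nonneg (formC ξ (t g))]
  obtain ⟨α, hα⟩ := exists_tendsto_ultrafilter U hbA
  obtain ⟨β, hβ⟩ := exists_tendsto_ultrafilter U hbB
  obtain ⟨γ, hγ⟩ := exists_tendsto_ultrafilter U hbC
  have hdisc : β ^ 2 - 4 * α * γ = 1 := by
    refine tendsto_nhds_unique ((hβ.pow 2).sub ((hα.const_mul 4).mul hγ)) ?_
    simp only [form_discrim]
    exact tendsto_const_nhds
  have hlimA : ∀ h : SL(2, ℝ), Filter.Tendsto (fun g => formA ξ (t g * h)) U
      (nhds (α * h 0 0 ^ 2 + β * h 0 0 * h 1 0 + γ * h 1 0 ^ 2)) := by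
    intro h
    simp only [formA_mul]
    exact ((hα.mul_const _).add ((hβ.mul_const _).mul_const _)).add (hγ.mul_const _)
  -- The points `t g h ∞` are almost all different from any given point.
  have hne : ∀ h : matrices (heckeGroup 6), Filter.Tendsto
      (fun g : matrices (heckeGroup 6) => imageOfInfty (t g * h.1)) U Filter.cofinite := by
    intro h
    refine Filter.le_cofinite_iff_eventually_ne.mpr fun p => ?_
    by_contra hcon
    rw [Filter.eventually_map, ← Ultrafilter.eventually_not] at hcon
    simp only [not_not] at hcon
    obtain ⟨g₀, hg₀⟩ := hcon.exists
    set u := t g₀ * h.1 with hu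
    have humem : u ∈ matrices (heckeGroup 6) := mul_mem (htmem _) h.2
    have hlimB : ∃ y, Filter.Tendsto (fun g => formB ξ (t g * h.1)) U (nhds y) := by
      simp only [formB_mul]
      exact ⟨_, ((((hα.const_mul 2).mul_const _).mul_const _).add (hβ.mul_const _)).add
        (((hγ.const_mul 2).mul_const _).mul_const _)⟩
    have hlimC : ∃ y, Filter.Tendsto (fun g => formC ξ (t g * h.1)) U (nhds y) := by
      simp only [formC_mul]
      exact ⟨_, ((hα.mul_const _).add ((hβ.mul_const _).mul_const _)).add (hγ.mul_const _)⟩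
    obtain ⟨yB, hyB⟩ := hlimB
    obtain ⟨yC, hyC⟩ := hlimC
    set R := max (|yB| + 1) (|yC| + 1)
    have hRB : ∀ᶠ g in (U : Filter (matrices (heckeGroup 6))), |formB ξ (t g * h.1)| ≤ R :=
      (hyB.abs.eventually (ge_mem_nhds (lt_add_one _))).mono fun g hg =>
        hg.trans (le_max_left _ _)
    have hRC : ∀ᶠ g in (U : Filter (matrices (heckeGroup 6))), |formC ξ (t g * h.1)| ≤ R :=
      (hyC.abs.eventually (ge_mem_nhds (lt_add_one _))).mono fun g hg =>
        hg.trans (le_max_right _ _)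
    obtain ⟨N, hN⟩ := abs_int_le_of_translate (R := R) (form_discrim ξ u)
    -- The elements `t g h` with image `p` are `± u T ^ i` with `|i| ≤ N`, so `g ∞` takes only
    -- finitely many values on them.
    have hfin : ((fun i : ℤ => imageOfInfty (u * matT (√3 * i) * h.1⁻¹)) ''
        Set.Icc (-N : ℤ) N).Finite := (Set.finite_Icc _ _).image _
    have hout := hcof hfin.compl_mem_cofinite
    obtain ⟨g, hgp, hgB, hgC, hgout⟩ := (hcon.and (hRB.and (hRC.and hout))).exists
    obtain ⟨i, hi⟩ := eq_mul_matT_of_imageOfInfty_eq (mul_mem (htmem g) h.2) humem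
      (hgp.trans hg₀.symm)
    have hB' : formB ξ (t g * h.1) = 2 * formA ξ u * (√3 * i) + formB ξ u := by
      rcases hi with hi | hi <;> rw [hi] <;> simp [formB_mul, formB_neg]
    have hC' : formC ξ (t g * h.1) =
        formA ξ u * (√3 * i) ^ 2 + formB ξ u * (√3 * i) + formC ξ u := by
      rcases hi with hi | hi <;> rw [hi] <;> simp [formC_mul, formC_neg]
    have hiN := hN i (hB' ▸ hgB) (hC' ▸ hgC)
    refine hgout ⟨i, abs_le.mp hiN, ?_⟩
    have htg : t g = t g * h.1 * h.1⁻¹ := by group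
    have : imageOfInfty g.1 = imageOfInfty (t g * h.1 * h.1⁻¹) := by
      rw [← htg]; exact (imageOfInfty_mul_matT _ _).symm
    simp only [this]
    rcases hi with hi | hi <;> rw [hi]
    rw [neg_mul, imageOfInfty_neg]
  refine ⟨α, β, γ, by rw [hdisc]; exact one_pos, ?_⟩
  simp only [markoffNumber, hdisc, Real.sqrt_one, ENNReal.ofReal_one, one_div]
  have hlim : ∀ h : SL(2, ℝ), Filter.Tendsto
      (fun g => (ENNReal.ofReal |formA ξ (t g * h)|)⁻¹) U
      (nhds (ENNReal.ofReal |α * h 0 0 ^ 2 + β * h 0 0 * h 1 0 + γ * h 1 0 ^ 2|)⁻¹) := fun h =>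
    (continuous_inv.tendsto _).comp
      ((ENNReal.continuous_ofReal.tendsto _).comp (hlimA h).abs)
  apply le_antisymm
  · refine iSup_le fun h₀ => le_of_forall_gt_imp_ge_of_dense fun z hz => ?_
    have hto : Filter.Tendsto (fun g => (⟨t g * h₀.1, mul_mem (htmem g) h₀.2⟩ :
        matrices (heckeGroup 6))) U
        (Filter.comap (fun g : matrices (heckeGroup 6) => imageOfInfty g.1) Filter.cofinite) :=
      Filter.tendsto_comap_iff.mpr (hne h₀)
    have hz' := hto.eventually (Filter.eventually_lt_of_limsup_lt (lt_of_eq_of_lt h hz))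
    exact le_of_tendsto (hlim h₀.1) (hz'.mono fun g hg => hg.le)
  · have h1 := hlim 1
    simp only [mul_one, htA] at h1
    refine le_trans (tendsto_nhds_unique hU h1).le ?_
    exact le_iSup (fun g : matrices (heckeGroup 6) => (ENNReal.ofReal
      |α * g.1 0 0 ^ 2 + β * g.1 0 0 * g.1 1 0 + γ * g.1 1 0 ^ 2|)⁻¹) 1

lemma dimH_lagrange_le_markoff (t : ℝ) :
    dimH (partBelow (lagrangeSpectrum (heckeGroup 6)) t) ≤
      dimH (partBelow (markoffSpectrum (heckeGroup 6)) t) := by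
  have hsub : partBelow (lagrangeSpectrum (heckeGroup 6)) t ⊆
      partBelow (markoffSpectrum (heckeGroup 6)) t ∪ {0} := by
    rintro x ⟨hx0, hxt, ξ, -, hξ⟩
    rcases hx0.eq_or_lt with rfl | hx
    · exact Or.inr rfl
    · exact Or.inl ⟨hx0, hxt, mem_markoffSpectrum_of_lagrangeNumber hx hξ⟩
  calc _ ≤ _ := dimH_mono hsub
    _ = _ := by rw [dimH_union, dimH_singleton, max_eq_left zero_le]

/-! ### Digits and the expansions they generate -/

/-- A matrix `[[s, q], [r, s]]` of determinant `1` with equal diagonal entries, of the shape allowed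
in `H_6`. It maps `[0, ∞]` onto the interval `[q / s, s / r]`, which is one of the intervals cut
out on `[0, ∞]` by the ideal hexagon with vertices `∞, 0, 1/√3, √3/2, 2/√3, √3`. -/
structure Digit where
  s : ℝ
  q : ℝ
  r : ℝ
  det : s ^ 2 - q * r = 1
  one_le_q : 1 ≤ q
  q_le : q ≤ 2
  one_le_r : 1 ≤ r
  r_le : r ≤ 2
  le_s : √3 ≤ s
  s_le : s ≤ 2
  integral : (∃ k l m : ℤ, s = k ∧ q = √3 * l ∧ r = √3 * m) ∨
    ∃ k l m : ℤ, s = √3 * k ∧ q = l ∧ r = m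

lemma sqrt_three_mul_self : √3 * √3 = (3 : ℝ) := Real.mul_self_sqrt (by norm_num)

lemma sqrt_three_gt : (1.732 : ℝ) < √3 := Real.lt_sqrt_of_sq_lt (by norm_num)

lemma sqrt_three_lt : √3 < (1.7321 : ℝ) := by
  rw [Real.sqrt_lt' (by norm_num)]; norm_num

namespace Digit

/-- The conjugate of a digit by `x ↦ 1 / x`. -/
def flip (d : Digit) : Digit where
  s := d.s
  q := d.r
  r := d.q
  det := by rw [mul_comm]; exact d.det
  one_le_q := d.one_le_r
  q_le := d.r_le
  one_le_r := d.one_le_q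
  r_le := d.q_le
  le_s := d.le_s
  s_le := d.s_le
  integral := by
    rcases d.integral with ⟨k, l, m, h⟩ | ⟨k, l, m, h⟩
    · exact Or.inl ⟨k, m, l, h.1, h.2.2, h.2.1⟩
    · exact Or.inr ⟨k, m, l, h.1, h.2.2, h.2.1⟩

/-- The Möbius transformation attached to a digit. -/
noncomputable def act (d : Digit) (x : ℝ) : ℝ := (d.s * x + d.q) / (d.r * x + d.s)

/-- The matrix of a digit. -/
noncomputable def mat (d : Digit) : SL(2, ℝ) :=
  ⟨!![d.s, d.q; d.r, d.s], by rw [Matrix.det_fin_two_of]; linarith [d.det]⟩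

@[simp] lemma mat_zero_zero (d : Digit) : d.mat 0 0 = d.s := rfl
@[simp] lemma mat_zero_one (d : Digit) : d.mat 0 1 = d.q := rfl
@[simp] lemma mat_one_zero (d : Digit) : d.mat 1 0 = d.r := rfl
@[simp] lemma mat_one_one (d : Digit) : d.mat 1 1 = d.s := rfl

variable (d : Digit)

lemma one_le_s : 1 ≤ d.s := by linarith [d.le_s, sqrt_three_gt]

lemma three_le_s_sq : 3 ≤ d.s * d.s := by
  nlinarith [d.le_s, sqrt_three_mul_self, sqrt_three_gt]

lemma denom_ge {x : ℝ} (hx : 0 ≤ x) : d.s ≤ d.r * x + d.s := by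
  nlinarith [d.one_le_r]

lemma denom_pos {x : ℝ} (hx : 0 ≤ x) : 0 < d.r * x + d.s := by
  linarith [d.denom_ge hx, d.one_le_s]

lemma act_mul_denom {x : ℝ} (hx : 0 ≤ x) : d.act x * (d.r * x + d.s) = d.s * x + d.q :=
  div_mul_cancel₀ _ (d.denom_pos hx).ne'

lemma act_pos {x : ℝ} (hx : 0 ≤ x) : 0 < d.act x := by
  have := d.one_le_q
  have := d.one_le_s
  exact div_pos (by nlinarith) (d.denom_pos hx)

lemma act_le_two {x : ℝ} (hx : 0 ≤ x) : d.act x ≤ 2 := by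
  rw [act, div_le_iff₀ (d.denom_pos hx)]
  nlinarith [d.one_le_r, d.one_le_s, d.s_le, d.q_le]

lemma le_act {x : ℝ} (hx : 0 ≤ x) : d.q ≤ d.s * d.act x := by
  rw [act, mul_div_assoc', le_div_iff₀ (d.denom_pos hx)]
  nlinarith [d.det]

lemma act_le {x : ℝ} (hx : 0 ≤ x) : d.r * d.act x ≤ d.s := by
  rw [act, mul_div_assoc', div_le_iff₀ (d.denom_pos hx)]
  nlinarith [d.det]

lemma act_sub_act {x y : ℝ} (hx : 0 ≤ x) (hy : 0 ≤ y) :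
    d.act x - d.act y = (x - y) / ((d.r * x + d.s) * (d.r * y + d.s)) := by
  have h1 := (d.denom_pos hx).ne'
  have h2 := (d.denom_pos hy).ne'
  rw [act, act, div_sub_div _ _ h1 h2]
  congr 1
  linear_combination (x - y) * d.det

lemma act_lt_act {x y : ℝ} (hx : 0 ≤ x) (hxy : x < y) : d.act x < d.act y := by
  have hy := hx.trans hxy.le
  rw [← sub_pos, d.act_sub_act hy hx]
  exact div_pos (sub_pos.mpr hxy) (mul_pos (d.denom_pos hy) (d.denom_pos hx))

lemma act_le_act {x y : ℝ} (hx : 0 ≤ x) (hxy : x ≤ y) : d.act x ≤ d.act y := by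
  rcases hxy.eq_or_lt with rfl | h
  · exact le_rfl
  · exact (d.act_lt_act hx h).le

lemma abs_act_sub_act_le {x y : ℝ} (hx : 0 ≤ x) (hy : 0 ≤ y) :
    |d.act x - d.act y| ≤ |x - y| / 3 := by
  have h1 := d.denom_pos hx
  have h2 := d.denom_pos hy
  rw [d.act_sub_act hx hy, abs_div, abs_of_pos (mul_pos h1 h2)]
  gcongr
  nlinarith [d.denom_ge hx, d.denom_ge hy, d.three_le_s_sq, d.one_le_s]

lemma le_abs_act_sub_act {x y : ℝ} (hx : 0 ≤ x) (hy : 0 ≤ y) (hx2 : x ≤ 2) (hy2 : y ≤ 2) :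
    |x - y| / 36 ≤ |d.act x - d.act y| := by
  have h1 := d.denom_pos hx
  have h2 := d.denom_pos hy
  have h3 : d.r * x + d.s ≤ 6 := by nlinarith [d.r_le, d.s_le, d.one_le_r]
  have h4 : d.r * y + d.s ≤ 6 := by nlinarith [d.r_le, d.s_le, d.one_le_r]
  rw [d.act_sub_act hx hy, abs_div, abs_of_pos (mul_pos h1 h2)]
  gcongr
  nlinarith

lemma flip_act_mul_act {x y : ℝ} (hx : 0 < x) (hxy : x * y = 1) : d.flip.act y * d.act x = 1 := by
  have hy : 0 < y := pos_of_mul_pos_right (by rw [hxy]; exact one_pos) hx.le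
  have h1 := d.denom_pos hx.le
  have h2 := d.flip.denom_pos hy.le
  rw [act, act, div_mul_div_comm, div_eq_one_iff_eq (mul_pos h2 h1).ne']
  simp only [flip]
  linear_combination (d.s ^ 2 - d.q * d.r) * hxy

end Digit

/-- The digit onto `[1/√3, √3/2]`. -/
noncomputable def two : Digit where
  s := √3
  q := 1
  r := 2
  det := by rw [sq, sqrt_three_mul_self]; norm_num
  one_le_q := le_rfl
  q_le := by norm_num
  one_le_r := by norm_num
  r_le := le_rfl
  le_s := le_rfl
  s_le := by linarith [sqrt_three_lt]
  integral := Or.inr ⟨1, 1, 2, by simp⟩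

/-- The digit onto `[√3/2, 2/√3]`. -/
noncomputable def three : Digit where
  s := 2
  q := √3
  r := √3
  det := by rw [sqrt_three_mul_self]; norm_num
  one_le_q := by linarith [sqrt_three_gt]
  q_le := by linarith [sqrt_three_lt]
  one_le_r := by linarith [sqrt_three_gt]
  r_le := by linarith [sqrt_three_lt]
  le_s := by linarith [sqrt_three_lt]
  s_le := le_rfl
  integral := Or.inl ⟨2, 1, 1, by simp⟩

/-- The digit onto `[2/√3, √3]`. -/
noncomputable def four : Digit := two.flip

/-- The effect of the two digits `4, 2` on a tail `x`. -/
noncomputable def pair (x : ℝ) : ℝ := four.act (two.act x)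

/-- The effect of the block of digits `(4, 2)ⁿ, 3` on a tail `x`. -/
noncomputable def block (n : ℕ) (x : ℝ) : ℝ := pair^[n] (three.act x)

lemma two_act_mem {x : ℝ} (hx : 0 ≤ x) : 1 ≤ √3 * two.act x ∧ 2 * two.act x ≤ √3 :=
  ⟨two.le_act hx, two.act_le hx⟩

lemma three_act_mem {x : ℝ} (hx : 0 ≤ x) : √3 ≤ 2 * three.act x ∧ √3 * three.act x ≤ 2 :=
  ⟨three.le_act hx, three.act_le hx⟩

lemma four_act_mem {x : ℝ} (hx : 0 ≤ x) : 2 ≤ √3 * four.act x ∧ four.act x ≤ √3 :=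
  ⟨four.le_act hx, by have := four.act_le hx; simpa [four, two, Digit.flip] using this⟩

lemma pair_pos {x : ℝ} (hx : 0 ≤ x) : 0 < pair x := four.act_pos (two.act_pos hx).le

lemma pair_le_two {x : ℝ} (hx : 0 ≤ x) : pair x ≤ 2 := four.act_le_two (two.act_pos hx).le

lemma pair_lt_pair {x y : ℝ} (hx : 0 ≤ x) (h : x < y) : pair x < pair y :=
  four.act_lt_act (two.act_pos hx).le (two.act_lt_act hx h)

lemma abs_pair_sub_pair_le {x y : ℝ} (hx : 0 ≤ x) (hy : 0 ≤ y) :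
    |pair x - pair y| ≤ |x - y| / 3 := by
  have h1 := four.abs_act_sub_act_le (two.act_pos hx).le (two.act_pos hy).le
  have h2 := two.abs_act_sub_act_le hx hy
  have h3 := abs_nonneg (x - y)
  simp only [pair]
  linarith

lemma le_abs_pair_sub_pair {x y : ℝ} (hx : 0 ≤ x) (hy : 0 ≤ y) (hx2 : x ≤ 2) (hy2 : y ≤ 2) :
    |x - y| / 36 ^ 2 ≤ |pair x - pair y| := by
  have h1 := four.le_abs_act_sub_act (two.act_pos hx).le (two.act_pos hy).le (two.act_le_two hx)
    (two.act_le_two hy)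
  have h2 := two.le_abs_act_sub_act hx hy hx2 hy2
  simp only [pair]
  linarith

lemma iterate_pair_mem (n : ℕ) {x : ℝ} (hx : 0 < x) (hx2 : x ≤ 2) :
    0 < pair^[n] x ∧ pair^[n] x ≤ 2 := by
  cases n with
  | zero => exact ⟨hx, hx2⟩
  | succ n =>
    have : 0 < pair^[n] x := by
      induction n with
      | zero => exact hx
      | succ n ih => rw [Function.iterate_succ_apply']; exact pair_pos ih.le
    rw [Function.iterate_succ_apply']
    exact ⟨pair_pos this.le, pair_le_two this.le⟩

lemma iterate_pair_lt (n : ℕ) {x y : ℝ} (hx : 0 < x) (hx2 : x ≤ 2) (h : x < y) :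
    pair^[n] x < pair^[n] y := by
  induction n with
  | zero => exact h
  | succ n ih =>
    rw [Function.iterate_succ_apply', Function.iterate_succ_apply']
    exact pair_lt_pair (iterate_pair_mem n hx hx2).1.le ih

lemma abs_iterate_pair_sub_le (n : ℕ) {x y : ℝ} (hx : 0 < x) (hx2 : x ≤ 2) (hy : 0 < y)
    (hy2 : y ≤ 2) : |pair^[n] x - pair^[n] y| ≤ |x - y| / 3 ^ n := by
  induction n with
  | zero => simp
  | succ n ih =>
    rw [Function.iterate_succ_apply', Function.iterate_succ_apply', pow_succ, ← div_div]
    have := abs_pair_sub_pair_le (iterate_pair_mem n hx hx2).1.le (iterate_pair_mem n hy hy2).1.le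
    linarith

lemma le_abs_iterate_pair_sub (n : ℕ) {x y : ℝ} (hx : 0 < x) (hx2 : x ≤ 2) (hy : 0 < y)
    (hy2 : y ≤ 2) : |x - y| / 36 ^ (2 * n) ≤ |pair^[n] x - pair^[n] y| := by
  induction n with
  | zero => simp
  | succ n ih =>
    rw [Function.iterate_succ_apply', Function.iterate_succ_apply', mul_add, mul_one, pow_add,
      ← div_div]
    have h1 := iterate_pair_mem n hx hx2
    have h2 := iterate_pair_mem n hy hy2
    have := le_abs_pair_sub_pair h1.1.le h2.1.le h1.2 h2.2
    have : |x - y| / 36 ^ (2 * n) / 36 ^ 2 ≤ |pair^[n] x - pair^[n] y| / 36 ^ 2 := by gcongr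
    linarith

lemma block_mem (n : ℕ) {x : ℝ} (hx : 0 ≤ x) : 0 < block n x ∧ block n x ≤ 2 :=
  iterate_pair_mem n (three.act_pos hx) (three.act_le_two hx)

lemma block_lt_block (n : ℕ) {x y : ℝ} (hx : 0 ≤ x) (h : x < y) : block n x < block n y :=
  iterate_pair_lt n (three.act_pos hx) (three.act_le_two hx) (three.act_lt_act hx h)

lemma block_le_block (n : ℕ) {x y : ℝ} (hx : 0 ≤ x) (h : x ≤ y) : block n x ≤ block n y := by
  rcases h.eq_or_lt with rfl | h
  · exact le_rfl
  · exact (block_lt_block n hx h).le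

lemma abs_block_sub_block_le (n : ℕ) {x y : ℝ} (hx : 0 ≤ x) (hy : 0 ≤ y) :
    |block n x - block n y| ≤ |x - y| / 3 := by
  have h1 := abs_iterate_pair_sub_le n (three.act_pos hx) (three.act_le_two hx)
    (three.act_pos hy) (three.act_le_two hy)
  have h2 := three.abs_act_sub_act_le hx hy
  have h3 : |three.act x - three.act y| / 3 ^ n ≤ |three.act x - three.act y| :=
    div_le_self (abs_nonneg _) (one_le_pow₀ (by norm_num))
  exact h1.trans (h3.trans h2)

lemma le_abs_block_sub_block (n : ℕ) {x y : ℝ} (hx : 0 ≤ x) (hy : 0 ≤ y) (hx2 : x ≤ 2)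
    (hy2 : y ≤ 2) : |x - y| / 36 ^ (2 * n + 1) ≤ |block n x - block n y| := by
  have h1 := le_abs_iterate_pair_sub n (three.act_pos hx) (three.act_le_two hx)
    (three.act_pos hy) (three.act_le_two hy)
  have h2 := three.le_abs_act_sub_act hx hy hx2 hy2
  refine le_trans ?_ h1
  rw [pow_succ', ← div_div]
  gcongr

lemma three_act_add_lt_pair {x y : ℝ} (hx : 0 ≤ x) (hx2 : x ≤ 2) (hy : 0 ≤ y) :
    three.act x + 1 / 10 ≤ pair y := by
  have h1 := three.act_le_act hx hx2
  have h2 := (four_act_mem (two.act_pos hy).le).1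
  have h3 : three.act 2 ≤ 1.05 := by
    have h := three.denom_pos (zero_le_two (α := ℝ))
    rw [Digit.act, div_le_iff₀ h]
    simp only [three]
    linarith [sqrt_three_gt]
  have h4 : (1.154 : ℝ) ≤ pair y := by
    rw [pair]
    nlinarith [sqrt_three_lt, sqrt_three_gt]
  linarith

lemma three_act_lt_pair {x y : ℝ} (hx : 0 ≤ x) (hy : 0 ≤ y) : three.act x < pair y := by
  have h1 := three.act_lt_act hx (lt_add_one x)
  have h2 := (three_act_mem (by linarith : 0 ≤ x + 1)).2
  have h3 := (four_act_mem (two.act_pos hy).le).1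
  rw [pair]
  have : √3 * three.act x < √3 * four.act (two.act y) := by
    have := mul_lt_mul_of_pos_left h1 (by positivity : (0 : ℝ) < √3)
    linarith
  exact lt_of_mul_lt_mul_left this (by positivity)

lemma block_lt_block_succ (n : ℕ) {x y : ℝ} (hx : 0 ≤ x) (hy : 0 ≤ y) :
    block n x < block (n + 1) y := by
  rw [block, block, Function.iterate_succ_apply]
  exact iterate_pair_lt n (three.act_pos hx) (three.act_le_two hx)
    (three_act_lt_pair hx (three.act_pos hy).le)

/-- Expansions are ordered lexicographically: a longer first block gives a larger value. -/
lemma block_lt_block_of_lt {m n : ℕ} (h : m < n) {x y : ℝ} (hx : 0 ≤ x) (hy : 0 ≤ y) :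
    block m x < block n y := by
  obtain ⟨k, rfl⟩ := Nat.exists_eq_add_of_lt h
  clear h
  induction k generalizing y with
  | zero => exact block_lt_block_succ m hx hy
  | succ k ih => exact (ih le_rfl).trans (block_lt_block_succ _ le_rfl hy)

/-- A quantitative form of the lexicographic order. -/
lemma le_block_succ_sub_block (n : ℕ) {x y : ℝ} (hx : 0 ≤ x) (hx2 : x ≤ 2) (hy : 0 ≤ y) :
    1 / 10 / 36 ^ (2 * n) ≤ |block (n + 1) y - block n x| := by
  have h0 := (three.act_pos hy).le
  have h1 := le_abs_iterate_pair_sub n (pair_pos h0) (pair_le_two h0)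
    (three.act_pos hx) (three.act_le_two hx)
  rw [block, block, Function.iterate_succ_apply]
  refine le_trans ?_ h1
  gcongr
  exact le_trans (by linarith [three_act_add_lt_pair hx hx2 h0]) (le_abs_self _)

/-- The value of the expansion `(4, 2)^{e 0}, 3, (4, 2)^{e 1}, 3, …`, truncated after `k` blocks and
continued by the tail `0`. -/
noncomputable def truncation : ℕ → (ℕ → ℕ) → ℝ
  | 0, _ => 0
  | k + 1, e => block (e 0) (truncation k fun i => e (i + 1))

/-- The value of the infinite expansion `(4, 2)^{e 0}, 3, (4, 2)^{e 1}, 3, …`. The truncations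
increase and are bounded, so their supremum is a limit. -/
noncomputable def expansion (e : ℕ → ℕ) : ℝ := ⨆ k, truncation k e

lemma truncation_mem (k : ℕ) (e : ℕ → ℕ) : 0 ≤ truncation k e ∧ truncation k e ≤ 2 := by
  induction k generalizing e with
  | zero => simp [truncation]
  | succ k ih => exact ⟨(block_mem _ (ih _).1).1.le, (block_mem _ (ih _).1).2⟩

lemma truncation_le_succ (k : ℕ) (e : ℕ → ℕ) : truncation k e ≤ truncation (k + 1) e := by
  induction k generalizing e with
  | zero => exact (truncation_mem 1 e).1
  | succ k ih => exact block_le_block _ (truncation_mem k _).1 (ih _)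

lemma tendsto_truncation (e : ℕ → ℕ) :
    Filter.Tendsto (fun k => truncation k e) Filter.atTop (nhds (expansion e)) :=
  tendsto_atTop_ciSup (monotone_nat_of_le_succ fun k => truncation_le_succ k e)
    ⟨2, by rintro _ ⟨k, rfl⟩; exact (truncation_mem k e).2⟩

lemma expansion_nonneg (e : ℕ → ℕ) : 0 ≤ expansion e :=
  ge_of_tendsto' (tendsto_truncation e) fun k => (truncation_mem k e).1

lemma expansion_le_two (e : ℕ → ℕ) : expansion e ≤ 2 :=
  le_of_tendsto' (tendsto_truncation e) fun k => (truncation_mem k e).2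

lemma expansion_eq (e : ℕ → ℕ) : expansion e = block (e 0) (expansion fun i => e (i + 1)) := by
  have h1 := (Filter.tendsto_add_atTop_iff_nat 1).mpr (tendsto_truncation e)
  refine tendsto_nhds_unique h1 ?_
  rw [tendsto_iff_dist_tendsto_zero]
  refine squeeze_zero (fun _ => dist_nonneg) (fun k => ?_)
    (tendsto_iff_dist_tendsto_zero.mp (tendsto_truncation fun i => e (i + 1)))
  rw [Real.dist_eq, Real.dist_eq]
  have := abs_block_sub_block_le (e 0) (truncation_mem k fun i => e (i + 1)).1
    (expansion_nonneg fun i => e (i + 1))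
  refine this.trans (div_le_self (abs_nonneg _) (by norm_num))

/-- Expansions with `k` common blocks differ by at most `2 / 3 ^ k`. -/
lemma abs_sub_le_of_eq_block (k : ℕ) {x y : ℕ → ℝ} {a : ℕ → ℕ}
    (hx0 : ∀ i, 0 ≤ x i ∧ x i ≤ 2) (hy0 : ∀ i, 0 ≤ y i ∧ y i ≤ 2)
    (hx : ∀ i < k, x i = block (a i) (x (i + 1))) (hy : ∀ i < k, y i = block (a i) (y (i + 1))) :
    |x 0 - y 0| ≤ 2 / 3 ^ k := by
  induction k generalizing x y a with
  | zero =>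
    rw [pow_zero, div_one, abs_le]
    constructor <;> linarith [(hx0 0).1, (hx0 0).2, (hy0 0).1, (hy0 0).2]
  | succ k ih =>
    have h1 := ih (x := fun i => x (i + 1)) (y := fun i => y (i + 1)) (a := fun i => a (i + 1))
      (fun i => hx0 _) (fun i => hy0 _) (fun i hi => hx _ (by omega)) (fun i hi => hy _ (by omega))
    rw [hx 0 (by omega), hy 0 (by omega), pow_succ, ← div_div]
    have := abs_block_sub_block_le (a 0) (hx0 (0 + 1)).1 (hy0 (0 + 1)).1
    linarith

/-! ### Descent of lattice vectors along the expansion -/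

/-- The vectors that occur as columns of the integral matrices: one coordinate is an integer and
the other is an integral multiple of `√3`. -/
def IsLattice (a c : ℝ) : Prop :=
  ∃ m n : ℤ, (a = m ∧ c = √3 * n) ∨ (a = √3 * m ∧ c = n)

lemma IsLattice.swap {a c : ℝ} (h : IsLattice a c) : IsLattice c a := by
  obtain ⟨m, n, h | h⟩ := h
  · exact ⟨n, m, Or.inr ⟨h.2, h.1⟩⟩
  · exact ⟨n, m, Or.inl ⟨h.2, h.1⟩⟩

lemma IsLattice.neg {a c : ℝ} (h : IsLattice a c) : IsLattice (-a) (-c) := by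
  obtain ⟨m, n, h | h⟩ := h
  · exact ⟨-m, -n, Or.inl ⟨by simp [h.1], by simp [h.2]⟩⟩
  · exact ⟨-m, -n, Or.inr ⟨by simp [h.1], by simp [h.2]⟩⟩

lemma IsLattice.one_le_left {a c : ℝ} (h : IsLattice a c) (ha : 0 < a) : 1 ≤ a := by
  have h3 : (1 : ℝ) ≤ √3 := by linarith [sqrt_three_gt]
  obtain ⟨m, n, ⟨rfl, -⟩ | ⟨rfl, -⟩⟩ := h
  · exact_mod_cast ha
  · have hm : (0 : ℝ) < m := pos_of_mul_pos_right ha (by positivity)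
    have : (1 : ℝ) ≤ m := by exact_mod_cast hm
    nlinarith

lemma IsLattice.one_le_right {a c : ℝ} (h : IsLattice a c) (hc : 0 < c) : 1 ≤ c :=
  h.swap.one_le_left hc

/-- Integral matrices preserve the set of lattice vectors. -/
lemma IsLattice.transform {a c : ℝ} (h : IsLattice a c) {g : SL(2, ℝ)} (hg : g ∈ integralMatrices) :
    IsLattice (g 0 0 * a + g 0 1 * c) (g 1 0 * a + g 1 1 * c) := by
  have h3 := sqrt_three_mul_self
  rcases hg with ⟨p, q, r, s, h1, h2, h3', h4⟩ | ⟨p, q, r, s, h1, h2, h3', h4⟩ <;>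
    obtain ⟨m, n, ⟨rfl, rfl⟩ | ⟨rfl, rfl⟩⟩ := h <;> rw [h1, h2, h3', h4]
  · exact ⟨p * m + 3 * q * n, r * m + s * n, Or.inl (by push_cast; constructor <;> grind)⟩
  · exact ⟨p * m + q * n, 3 * r * m + s * n, Or.inr (by push_cast; constructor <;> grind)⟩
  · exact ⟨p * m + q * n, r * m + 3 * s * n, Or.inr (by push_cast; constructor <;> grind)⟩
  · exact ⟨3 * p * m + q * n, r * m + s * n, Or.inl (by push_cast; constructor <;> grind)⟩

lemma isLattice_column {g : SL(2, ℝ)} (hg : g ∈ integralMatrices) :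
    IsLattice (g 0 0) (g 1 0) := by
  have := IsLattice.transform (a := 1) (c := 0) ⟨1, 0, by simp⟩ hg
  simpa using this

lemma Digit.mat_mem_integralMatrices (d : Digit) : d.mat ∈ integralMatrices := by
  rcases d.integral with ⟨k, l, m, h1, h2, h3⟩ | ⟨k, l, m, h1, h2, h3⟩
  · exact Or.inl ⟨k, l, m, k, h1, h2, h3, h1⟩
  · exact Or.inr ⟨k, l, m, k, h1, h2, h3, h1⟩

/-- A nonzero lattice vector with nonnegative coordinates. -/
structure IsConeVector (a c : ℝ) : Prop where
  lattice : IsLattice a c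
  left : 0 ≤ a
  right : 0 ≤ c
  pos : 0 < a + c

/-- The absolute value at `(a, c)` of the form of discriminant `1` with roots `ξ` and `-1 / ρ`. -/
noncomputable def weight (ξ ρ a c : ℝ) : ℝ := |a - ξ * c| * |ρ * a + c| / (ρ * ξ + 1)

/-- The edge `[0, ∞]` crossed by the geodesic from `-1 / ρ` to `ξ` is `B`-good if the form with
these roots has absolute value at least `B` at both its ends. -/
def IsGoodEdge (B ξ ρ : ℝ) : Prop := B ≤ weight ξ ρ 1 0 ∧ B ≤ weight ξ ρ 0 1

lemma isGoodEdge_of {B ξ ρ : ℝ} (hξ : 0 < ξ) (hρ : 0 < ρ) (h1 : B * (ξ + 1 / ρ) ≤ 1)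
    (h2 : B * (ρ + 1 / ξ) ≤ 1) : IsGoodEdge B ξ ρ := by
  have h : 0 < ρ * ξ + 1 := by positivity
  constructor
  · simp only [weight, mul_zero, sub_zero, mul_one, add_zero, abs_one, one_mul, abs_of_pos hρ]
    rw [le_div_iff₀ h]
    have : B * (ρ * ξ + 1) = B * (ξ + 1 / ρ) * ρ := by field_simp
    rw [this]
    nlinarith
  · simp only [weight, mul_zero, zero_sub, mul_one, zero_add, abs_one, abs_neg, abs_of_pos hξ]
    rw [le_div_iff₀ h]
    have : B * (ρ * ξ + 1) = B * (ρ + 1 / ξ) * ξ := by field_simp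
    rw [this]
    nlinarith

lemma weight_neg (ξ ρ a c : ℝ) : weight ξ ρ (-a) (-c) = weight ξ ρ a c := by
  simp only [weight]
  congr 1
  rw [show -a - ξ * -c = -(a - ξ * c) by ring, show ρ * -a + -c = -(ρ * a + c) by ring, abs_neg,
    abs_neg]

/-- Removing a digit from `ξ` and from a vector appends the flipped digit to `ρ` and does not change
the weight. -/
lemma Digit.weight_act (d : Digit) {x ρ : ℝ} (hx : 0 ≤ x) (hρ : 0 ≤ ρ) (a c : ℝ) :
    weight (d.act x) ρ (d.s * a + d.q * c) (d.r * a + d.s * c) =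
      weight x (d.flip.act ρ) a c := by
  have hw := d.denom_pos hx
  have hu : 0 < d.q * ρ + d.s := d.flip.denom_pos hρ
  have hρ' := (d.flip.act_pos hρ).le
  have hx1 := d.act_mul_denom hx
  have hρ1 : d.flip.act ρ * (d.q * ρ + d.s) = d.s * ρ + d.r := d.flip.act_mul_denom hρ
  have e1 : d.s * a + d.q * c - d.act x * (d.r * a + d.s * c) = (a - x * c) / (d.r * x + d.s) := by
    rw [eq_div_iff hw.ne']
    linear_combination (-(d.r * a + d.s * c)) * hx1 + (a - c * x) * d.det
  have e2 : ρ * (d.s * a + d.q * c) + (d.r * a + d.s * c) =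
      (d.q * ρ + d.s) * (d.flip.act ρ * a + c) := by
    linear_combination (-a) * hρ1
  have e3 : ρ * d.act x + 1 =
      (d.q * ρ + d.s) * (d.flip.act ρ * x + 1) / (d.r * x + d.s) := by
    rw [eq_div_iff hw.ne']
    linear_combination ρ * hx1 - x * hρ1
  have h4 : 0 < d.flip.act ρ * x + 1 := by positivity
  rw [weight, weight, e1, e2, e3, abs_div, abs_mul, abs_of_pos hw, abs_of_pos hu]
  generalize d.r * x + d.s = w at *
  generalize d.q * ρ + d.s = u at *
  field_simp

/-- A cone vector either has large weight, or remains in the cone after a digit has been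
removed. -/
lemma Digit.descend (d : Digit) {x ρ a c B : ℝ} (hx : 0 ≤ x) (hρ : 0 ≤ ρ) (hv : IsConeVector a c)
    (hB : B ≤ 1 / 2) (hedge : IsGoodEdge B (d.act x) ρ) :
    B ≤ weight (d.act x) ρ a c ∨ ∃ a' c', IsConeVector a' c' ∧
      weight x (d.flip.act ρ) a' c' = weight (d.act x) ρ a c ∧ 2 * (a' + c') ≤ a + c := by
  have hξ := d.act_pos hx
  have hD : 0 < ρ * d.act x + 1 := by positivity
  have hs := d.one_le_s
  have hr := d.one_le_r
  have hq := d.one_le_q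
  rcases hv.left.eq_or_lt with rfl | ha
  · left
    have hc : 0 < c := by simpa using hv.pos
    have hc1 := hv.lattice.one_le_right hc
    refine hedge.2.trans ?_
    simp only [weight, mul_zero, zero_sub, zero_add, abs_neg, abs_mul, abs_one]
    gcongr <;> exact hc1.trans (le_abs_self _)
  rcases hv.right.eq_or_lt with rfl | hc
  · left
    have ha1 := hv.lattice.one_le_left ha
    refine hedge.1.trans ?_
    simp only [weight, mul_zero, sub_zero, add_zero, abs_mul, abs_one]
    gcongr <;> exact ha1.trans (le_abs_self _)
  have ha1 := hv.lattice.one_le_left ha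
  have hc1 := hv.lattice.one_le_right hc
  set a' := d.s * a - d.q * c with ha'
  set c' := d.s * c - d.r * a with hc'
  have hL : IsLattice a' c' := by
    have := hv.lattice.transform (inv_mem d.mat_mem_integralMatrices)
    convert this using 1 <;>
    simp [inv_entries] <;> ring
  have ea : a = d.s * a' + d.q * c' := by rw [ha', hc']; linear_combination (-a) * d.det
  have ec : c = d.r * a' + d.s * c' := by rw [ha', hc']; linear_combination (-c) * d.det
  have habs : |ρ * a + c| = ρ * a + c := abs_of_pos (by positivity)
  rcases lt_or_ge a' 0 with h1 | h1
  -- The slope `a / c` is below the interval of the digit: the lattice coordinate `d.q * c - d.s * a` is at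
  -- least `1`, and the worst case is `d.act x = d.q / d.s`.
  · left
    have h2 : 1 ≤ d.q * c - d.s * a := by
      have := hL.neg.one_le_left (by linarith); linarith
    have h3 := d.le_act hx
    have h4 : d.act x * c - a ≥ 1 / 2 * d.act x := by
      have : d.q * (d.act x * c - a) ≥ d.act x := by nlinarith
      nlinarith [d.q_le]
    rw [weight, habs, abs_sub_comm, le_div_iff₀ hD]
    have h5 := le_abs_self (d.act x * c - a)
    have h6 : 1 / 2 * (ρ * d.act x + 1) ≤ (d.act x * c - a) * (ρ * a + c) := by
      have h7 : a * (ρ * d.act x + 1) ≤ d.act x * (ρ * a + c) := by nlinarith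
      have h8 : ρ * d.act x + 1 ≤ a * (ρ * d.act x + 1) := by nlinarith
      have h9 := mul_le_mul_of_nonneg_right h4 (by positivity : 0 ≤ ρ * a + c)
      linarith
    nlinarith [mul_le_mul_of_nonneg_right h5 (by positivity : 0 ≤ ρ * a + c)]
  rcases lt_or_ge c' 0 with h1' | h1'
  -- The slope `a / c` is above the interval of the digit.
  · left
    have h2 : 1 ≤ d.r * a - d.s * c := by
      have := hL.neg.one_le_right (by linarith); linarith
    have h3 := d.act_le hx
    have h4 : a - d.act x * c ≥ 1 / 2 := by
      have : d.r * (a - d.act x * c) ≥ 1 := by nlinarith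
      nlinarith [d.r_le]
    rw [weight, habs, le_div_iff₀ hD]
    have h5 := le_abs_self (a - d.act x * c)
    have h6 : ρ * d.act x + 1 ≤ ρ * a + c := by nlinarith
    have : B * (ρ * d.act x + 1) ≤ 1 / 2 * (ρ * a + c) := by gcongr
    nlinarith [mul_le_mul_of_nonneg_right (h4.le.trans h5) (by positivity : 0 ≤ ρ * a + c)]
  · right
    refine ⟨a', c', ⟨hL, h1, h1', ?_⟩, ?_, ?_⟩
    · by_contra h
      have h2 : a' = 0 := by linarith
      have h3 : c' = 0 := by linarith
      rw [h2, h3] at ea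
      simp at ea
      linarith
    · rw [← d.weight_act hx hρ, ← ea, ← ec]
    · have : (1.7 : ℝ) ≤ d.s := by linarith [d.le_s, sqrt_three_gt]
      rw [ea, ec]
      nlinarith

lemma two_act_ge {y : ℝ} (hy : √3 ≤ 2 * y) : (0.7216 : ℝ) ≤ two.act y := by
  have h3 := sqrt_three_gt
  have h3' := sqrt_three_lt
  rw [Digit.act, le_div_iff₀ (two.denom_pos (by linarith))]
  simp only [two]
  nlinarith

lemma pair_le {y : ℝ} (hy : 0 ≤ y) : pair y ≤ 1.3475 := by
  have h3 := sqrt_three_gt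
  have h3' := sqrt_three_lt
  have hz := (two_act_mem hy).2
  have hz0 := (two.act_pos hy).le
  rw [pair, Digit.act, div_le_iff₀ (four.denom_pos hz0)]
  simp only [four, Digit.flip]
  generalize two.act y = z at *
  simp only [two]
  nlinarith

lemma two_le_pair {y : ℝ} (hy : 0 ≤ y) : 2 ≤ √3 * pair y := (four_act_mem (two.act_pos hy).le).1

lemma sqrt_three_le_pair {y : ℝ} (hy : 0 ≤ y) : √3 ≤ 2 * pair y := by
  have := two_le_pair hy
  nlinarith [sqrt_three_gt, sqrt_three_lt]

lemma sqrt_three_le_iterate_pair (m : ℕ) {x : ℝ} (hx : √3 ≤ 2 * x) : √3 ≤ 2 * pair^[m] x := by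
  induction m with
  | zero => exact hx
  | succ m ih =>
    rw [Function.iterate_succ_apply']
    exact sqrt_three_le_pair (by linarith [sqrt_three_gt])

lemma two_le_block {n : ℕ} (hn : 1 ≤ n) {x : ℝ} (hx : 0 ≤ x) : 2 ≤ √3 * block n x := by
  obtain ⟨m, rfl⟩ := Nat.exists_eq_add_of_le' hn
  rw [block, Function.iterate_succ_apply']
  exact two_le_pair (iterate_pair_mem m (three.act_pos hx) (three.act_le_two hx)).1.le

/-- The edges inside a run of digits `4, 2` that are entered by the digit `2`. -/
lemma isGoodEdge_two {B x ρ : ℝ} (hB0 : 0 ≤ B) (hB : B * 2.26 ≤ 1) (hx : √3 ≤ 2 * x)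
    (hρ : √3 ≤ 2 * ρ) : IsGoodEdge B (two.act x) (two.act ρ) := by
  have h3 := sqrt_three_gt
  have h3' := sqrt_three_lt
  have hx0 : 0 ≤ x := by linarith
  have hρ0 : 0 ≤ ρ := by linarith
  have key : ∀ y z : ℝ, √3 ≤ 2 * y → √3 ≤ 2 * z → two.act y + 1 / two.act z ≤ 2.26 := by
    intro y z hy hz
    have h1 := (two_act_mem (by linarith : 0 ≤ y)).2
    have h2 : 1 / two.act z ≤ 1 / 0.7216 := by
      gcongr; exact two_act_ge hz
    norm_num at h2 ⊢
    linarith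
  exact isGoodEdge_of (two.act_pos hx0) (two.act_pos hρ0)
    ((mul_le_mul_of_nonneg_left (key _ _ hx hρ) hB0).trans hB)
    ((mul_le_mul_of_nonneg_left (key _ _ hρ hx) hB0).trans hB)

/-- The edges inside a run of digits `4, 2` that are entered by the digit `4`. -/
lemma isGoodEdge_pair {B x ρ : ℝ} (hB0 : 0 ≤ B) (hB : B * 2.26 ≤ 1) (hx : 0 ≤ x)
    (hρ : 0 ≤ ρ) : IsGoodEdge B (pair x) (pair ρ) := by
  have h3 := sqrt_three_gt
  have h3' := sqrt_three_lt
  have key : ∀ y z : ℝ, 0 ≤ y → 0 ≤ z → pair y + 1 / pair z ≤ 2.26 := by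
    intro y z hy hz
    have h1 := pair_le hy
    have h2 : 1 / pair z ≤ √3 / 2 := by
      rw [div_le_div_iff₀ (pair_pos hz) two_pos]
      linarith [two_le_pair hz]
    linarith
  exact isGoodEdge_of (pair_pos hx) (pair_pos hρ)
    ((mul_le_mul_of_nonneg_left (key _ _ hx hρ) hB0).trans hB)
    ((mul_le_mul_of_nonneg_left (key _ _ hρ hx) hB0).trans hB)

/-- Descent through a run of digits `4, 2`. Only the first edge has to be assumed good. -/
lemma descend_iterate_pair (m : ℕ) {x ρ a c B : ℝ} (hB0 : 0 ≤ B) (hB : B * 2.26 ≤ 1)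
    (hx : √3 ≤ 2 * x) (hρ : √3 ≤ 2 * ρ) (hv : IsConeVector a c)
    (hedge : m ≠ 0 → IsGoodEdge B (pair^[m] x) ρ) :
    B ≤ weight (pair^[m] x) ρ a c ∨ ∃ a' c', IsConeVector a' c' ∧
      weight x (pair^[m] ρ) a' c' = weight (pair^[m] x) ρ a c ∧ a' + c' ≤ a + c := by
  induction m generalizing ρ a c with
  | zero => exact Or.inr ⟨a, c, hv, rfl, le_rfl⟩
  | succ m ih =>
    have h3 := sqrt_three_gt
    have hB2 : B ≤ 1 / 2 := by linarith
    have hy := sqrt_three_le_iterate_pair m hx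
    have hy0 : 0 ≤ pair^[m] x := by linarith
    have hρ0 : 0 ≤ ρ := by linarith
    have hedge := hedge (Nat.succ_ne_zero m)
    rw [Function.iterate_succ_apply'] at hedge ⊢
    rw [Function.iterate_succ_apply]
    rcases four.descend (two.act_pos hy0).le hρ0 hv hB2 hedge with h | ⟨a₁, c₁, hv₁, hw₁, hs₁⟩
    · exact Or.inl h
    have hedge₁ : IsGoodEdge B (two.act (pair^[m] x)) (four.flip.act ρ) :=
      isGoodEdge_two hB0 hB hy hρ
    have hρ1 : 0 ≤ four.flip.act ρ := (two.act_pos hρ0).le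
    rcases two.descend hy0 hρ1 hv₁ hB2 hedge₁ with h | ⟨a₂, c₂, hv₂, hw₂, hs₂⟩
    · exact Or.inl (hw₁ ▸ h)
    have hw : weight (pair^[m] x) (pair ρ) a₂ c₂ = weight (pair (pair^[m] x)) ρ a c :=
      hw₂.trans hw₁
    have hedge₂ : m ≠ 0 → IsGoodEdge B (pair^[m] x) (pair ρ) := by
      intro hm
      obtain ⟨k, rfl⟩ := Nat.exists_eq_succ_of_ne_zero hm
      rw [Function.iterate_succ_apply']
      have := sqrt_three_le_iterate_pair k hx
      exact isGoodEdge_pair hB0 hB (by linarith) hρ0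
    have hpos₁ := hv₁.pos
    have hpos₂ := hv₂.pos
    rcases ih (sqrt_three_le_pair hρ0) hv₂ hedge₂ with h | ⟨a₃, c₃, hv₃, hw₃, hs₃⟩
    · exact Or.inl (hw ▸ h)
    · exact Or.inr ⟨a₃, c₃, hv₃, hw₃.trans hw, by linarith⟩

/-- The width, seen from the cusp `∞`, of the geodesic from `-1 / three.act q` to `p`: its future
after a digit `3` is `p`, and its past before that digit, read backwards and with the digits `2` and
`4` exchanged, is `q`. Exchanging `p` and `q` gives the width seen from the cusp `0` just before that
digit. -/
noncomputable def height (p q : ℝ) : ℝ := p + 1 / three.act q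

/-- Descent through a block `3, (4, 2)ⁿ`. Only the edges before and after the digit `3` can have a
width larger than `2.26`, and only at one end: these widths are the two heights. -/
lemma descend_block {n : ℕ} (hn : 1 ≤ n) {p q a c B : ℝ} (hB0 : 0 ≤ B) (hB : B * 2.26 ≤ 1)
    (hp : 0 ≤ p) (hq : 2 ≤ √3 * q) (hv : IsConeVector a c)
    (h1 : B * height (block n p) q ≤ 1) (h2 : B * height q (block n p) ≤ 1) :
    B ≤ weight (three.act (block n p)) q a c ∨ ∃ a' c', IsConeVector a' c' ∧
      weight (three.act p) (block n q) a' c' = weight (three.act (block n p)) q a c ∧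
      2 * (a' + c') ≤ a + c := by
  have h3 := sqrt_three_gt
  have h3' := sqrt_three_lt
  have hB2 : B ≤ 1 / 2 := by linarith
  have hP := two_le_block hn hp
  have hP0 := (block_mem n hp).1
  have hq0 : 0 < q := by nlinarith
  have key : ∀ y z : ℝ, 0 ≤ y → 0 < z → 2 ≤ √3 * z → three.act y + 1 / z ≤ 2.26 := by
    intro y z hy hz hz2
    have h4 := (three_act_mem hy).2
    have h4' : three.act y ≤ 1.16 := by nlinarith
    have h5 : 1 / z ≤ √3 / 2 := by
      rw [div_le_div_iff₀ hz two_pos]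
      linarith
    linarith
  have e1 : IsGoodEdge B (three.act (block n p)) q :=
    isGoodEdge_of (three.act_pos hP0.le) hq0
      ((mul_le_mul_of_nonneg_left (key _ _ hP0.le hq0 hq) hB0).trans hB) h2
  have e2 : IsGoodEdge B (block n p) (three.act q) :=
    isGoodEdge_of hP0 (three.act_pos hq0.le) h1
      ((mul_le_mul_of_nonneg_left (key _ _ hq0.le hP0 hP) hB0).trans hB)
  rcases three.descend hP0.le hq0.le hv hB2 e1 with h | ⟨a₁, c₁, hv₁, hw₁, hs₁⟩
  · exact Or.inl h
  rcases descend_iterate_pair n hB0 hB (three_act_mem hp).1 (three_act_mem hq0.le).1 hv₁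
    (fun _ => e2) with h | ⟨a₂, c₂, hv₂, hw₂, hs₂⟩
  · exact Or.inl (hw₁ ▸ h)
  · exact Or.inr ⟨a₂, c₂, hv₂, hw₂.trans hw₁, by linarith⟩

/-- Along an expansion all of whose heights from the `J`-th block on are at most `1 / B`, every cone
vector has weight at least `B`: otherwise it could be descended forever, its size being halved by
every block. -/
lemma le_weight_of_height_le {e : ℕ → ℕ} (he : ∀ j, 1 ≤ e j) {p q : ℕ → ℝ}
    (hp0 : ∀ j, 0 ≤ p j) (hp : ∀ j, p j = block (e j) (p (j + 1)))
    (hq0 : ∀ j, 0 ≤ q j) (hq : ∀ j, q (j + 1) = block (e j) (q j)) {B : ℝ} (hB0 : 0 ≤ B)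
    (hB : B * 2.26 ≤ 1) {J : ℕ} (hJ : 1 ≤ J)
    (h : ∀ j, J ≤ j → B * height (p j) (q j) ≤ 1 ∧ B * height (q j) (p j) ≤ 1)
    {a c : ℝ} (hv : IsConeVector a c) : B ≤ weight (three.act (p J)) (q J) a c := by
  have main : ∀ k j : ℕ, J ≤ j → ∀ a c : ℝ, IsConeVector a c → a + c < 2 ^ k →
      B ≤ weight (three.act (p j)) (q j) a c := by
    intro k
    induction k with
    | zero =>
      intro j _ a c hv hlt
      exfalso
      rw [pow_zero] at hlt
      rcases hv.left.eq_or_lt with rfl | ha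
      · have := hv.lattice.one_le_right (by simpa using hv.pos)
        linarith
      · have := hv.lattice.one_le_left ha
        linarith [hv.right]
    | succ k ih =>
      intro j hj a c hv hlt
      obtain ⟨i, rfl⟩ := Nat.exists_eq_add_of_le' (hJ.trans hj)
      have hh := h _ hj
      rw [hp (i + 1)] at hh ⊢
      rcases descend_block (he (i + 1)) hB0 hB (hp0 _) (by rw [hq]; exact two_le_block (he i) (hq0 i))
        hv hh.1 hh.2 with h' | ⟨a', c', hv', hw, hs⟩
      · exact h'
      · rw [← hw, ← hq]
        exact ih _ (by omega) a' c' hv' (by rw [pow_succ] at hlt; linarith)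
  obtain ⟨k, hk⟩ := pow_unbounded_of_one_lt (a + c) (one_lt_two (α := ℝ))
  exact main k J le_rfl a c hv hk

/-! ### Matrices of the expansion -/

/-- The matrix `M` of an initial segment of an expansion: it belongs to `H_6`, maps the tail `x` to
`ξ`, and the inverse of `M` maps `∞` to `-1 / ρ`. The number `k` is a lower bound for the size of
the second row. -/
structure Carries (k : ℕ) (M : SL(2, ℝ)) (ξ x ρ : ℝ) : Prop where
  mem : M ∈ matrices (heckeGroup 6)
  x_nonneg : 0 ≤ x
  ρ_nonneg : 0 ≤ ρ
  nonneg : 0 ≤ M 1 0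
  one_le : 1 ≤ M 1 1
  le_add : k ≤ M 1 0 + M 1 1
  image : ξ * (M 1 0 * x + M 1 1) = M 0 0 * x + M 0 1
  past : ρ * M 1 1 = M 1 0

lemma four_mat_mem : four.mat ∈ matrices (heckeGroup 6) := by
  have : four.mat = matT √3 * matS * matT √3 := by
    ext i j
    rw [mul_entry, mul_entry, mul_entry]
    fin_cases i <;> fin_cases j <;>
      simp [four, two, Digit.flip, matS]
    linarith [sqrt_three_mul_self]
  rw [this]
  exact mul_mem (mul_mem matT_mem matS_mem) matT_mem

lemma three_mat_mem : three.mat ∈ matrices (heckeGroup 6) := by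
  have : three.mat = four.mat * matS * matT √3 := by
    ext i j
    rw [mul_entry, mul_entry, mul_entry]
    fin_cases i <;> fin_cases j <;>
      simp [four, two, three, Digit.flip, matS] <;>
      linarith [sqrt_three_mul_self]
  rw [this]
  exact mul_mem (mul_mem four_mat_mem matS_mem) matT_mem

lemma two_mat_mem : two.mat ∈ matrices (heckeGroup 6) := by
  have : two.mat = three.mat * matS * matT √3 := by
    ext i j
    rw [mul_entry, mul_entry, mul_entry]
    fin_cases i <;> fin_cases j <;>
      simp [two, three, matS] <;>
      linarith [sqrt_three_mul_self]
  rw [this]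
  exact mul_mem (mul_mem three_mat_mem matS_mem) matT_mem

lemma carries_one {x : ℝ} (hx : 0 ≤ x) : Carries 0 1 x x 0 where
  mem := one_mem _
  x_nonneg := hx
  ρ_nonneg := le_rfl
  nonneg := by simp
  one_le := by simp
  le_add := by simp
  image := by simp
  past := by simp

lemma Carries.digit {k : ℕ} {M : SL(2, ℝ)} {ξ x ρ : ℝ} {d : Digit}
    (hd : d.mat ∈ matrices (heckeGroup 6)) (hx : 0 ≤ x) (h : Carries k M ξ (d.act x) ρ) :
    Carries (k + 1) (M * d.mat) ξ x (d.flip.act ρ) := by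
  have h1 := h.nonneg
  have h2 := h.one_le
  have hs := d.one_le_s
  have hr := d.one_le_r
  have hq := d.one_le_q
  have hk := h.le_add
  have hx1 := d.act_mul_denom hx
  have hρ1 : d.flip.act ρ * (d.q * ρ + d.s) = d.s * ρ + d.r := d.flip.act_mul_denom h.ρ_nonneg
  have hp := h.past
  have hi := h.image
  constructor
  · exact mul_mem h.mem hd
  · exact hx
  · exact (d.flip.act_pos h.ρ_nonneg).le
  all_goals simp only [mul_entry, Digit.mat_zero_zero, Digit.mat_zero_one, Digit.mat_one_zero,
    Digit.mat_one_one]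
  · positivity
  · nlinarith
  · push_cast; nlinarith
  · linear_combination (d.r * x + d.s) * hi + (M 0 0 - ξ * M 1 0) * hx1
  · linear_combination M 1 1 * hρ1 + (d.s - d.flip.act ρ * d.q) * hp

lemma Carries.iterate_pair {k : ℕ} {ξ x : ℝ} (hx : 0 < x) (hx2 : x ≤ 2) (m : ℕ) {M : SL(2, ℝ)}
    {ρ : ℝ} (h : Carries k M ξ (pair^[m] x) ρ) : ∃ M', Carries k M' ξ x (pair^[m] ρ) := by
  induction m generalizing M ρ with
  | zero => exact ⟨M, h⟩
  | succ m ih =>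
    rw [Function.iterate_succ_apply'] at h
    have h0 := (iterate_pair_mem m hx hx2).1.le
    have h1 := (h.digit four_mat_mem (two.act_pos h0).le).digit two_mat_mem h0
    have hk := h1.le_add
    push_cast at hk
    rw [Function.iterate_succ_apply]
    exact ih { h1 with le_add := by linarith }

lemma Carries.block {k n : ℕ} {M : SL(2, ℝ)} {ξ x ρ : ℝ} (hx : 0 ≤ x)
    (h : Carries k M ξ (three.act (block n x)) ρ) :
    ∃ M', Carries (k + 1) M' ξ (three.act x) (HeckeSpectra.block n ρ) :=
  (h.digit three_mat_mem (block_mem n hx).1.le).iterate_pair (three.act_pos hx)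
    (three.act_le_two hx) n

/-- The matrices of the segments of an expansion that stop just before a digit `3`. -/
lemma exists_carries {e : ℕ → ℕ} {p q : ℕ → ℝ} (hp0 : ∀ j, 0 ≤ p j)
    (hp : ∀ j, p j = block (e j) (p (j + 1))) (hq00 : q 0 = 0)
    (hq : ∀ j, q (j + 1) = block (e j) (q j)) (j : ℕ) :
    ∃ M, Carries j M (three.act (p 0)) (three.act (p j)) (q j) := by
  induction j with
  | zero => exact ⟨1, hq00 ▸ carries_one (three.act_pos (hp0 0)).le⟩
  | succ j ih =>
    obtain ⟨M, hM⟩ := ih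
    rw [hp j] at hM
    obtain ⟨M', hM'⟩ := hM.block (hp0 _)
    exact ⟨M', hq j ▸ hM'⟩

/-- The matrix of a segment transports the form with roots `ξ` and `∞` to the form with roots `x` and
`-1 / ρ`. -/
lemma Carries.weight_eq {k : ℕ} {M : SL(2, ℝ)} {ξ x ρ : ℝ} (h : Carries k M ξ x ρ) (a c : ℝ) :
    weight ξ 0 (M 0 0 * a + M 0 1 * c) (M 1 0 * a + M 1 1 * c) = weight x ρ a c := by
  have hx := h.x_nonneg
  have h0 := h.nonneg
  have h1 := h.one_le
  have hρ := h.ρ_nonneg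
  have hw : 0 < M 1 0 * x + M 1 1 := by positivity
  have e1 : M 0 0 * a + M 0 1 * c - ξ * (M 1 0 * a + M 1 1 * c) =
      (a - x * c) / (M 1 0 * x + M 1 1) := by
    rw [eq_div_iff hw.ne']
    linear_combination (-(M 1 0 * a + M 1 1 * c)) * h.image + (a - x * c) * det_eq_one M
  have e2 : M 1 0 * a + M 1 1 * c = M 1 1 * (ρ * a + c) := by
    linear_combination (-a) * h.past
  have e3 : M 1 0 * x + M 1 1 = M 1 1 * (ρ * x + 1) := by linear_combination (-x) * h.past
  have h5 : 0 < ρ * x + 1 := by positivity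
  have h6 : 0 < M 1 1 := by positivity
  rw [weight, weight, e1, zero_mul, zero_add, zero_mul, zero_add, e2, e3, abs_div, abs_mul, abs_mul,
    abs_of_pos h5, abs_of_pos h6]
  generalize M 1 1 = u at *
  field_simp

/-- A vector whose slope is close to `ξ` is carried by the inverse of `M` into the cone. -/
lemma Carries.exists_isConeVector {k : ℕ} {M : SL(2, ℝ)} {ξ x ρ : ℝ} (h : Carries k M ξ x ρ)
    (hx : 0 < x) : ∃ η > 0, ∀ a c : ℝ, IsLattice a c → 0 < c → |a - ξ * c| < η * c →
      ∃ a' c', IsConeVector a' c' ∧ weight x ρ a' c' = weight ξ 0 a c := by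
  have h0 := h.nonneg
  have h1 := h.one_le
  have hw : 0 < M 1 0 * x + M 1 1 := by positivity
  refine ⟨min (x / (M 1 0 * x + M 1 1) / M 1 1) (1 / (M 1 0 * x + M 1 1) / (M 1 0 + 1)),
    lt_min (by positivity) (by positivity), fun a c hL hc hac => ?_⟩
  have hdet := det_eq_one M
  have f1 : M 1 1 * ξ - M 0 1 = x / (M 1 0 * x + M 1 1) := by
    rw [eq_div_iff hw.ne']
    linear_combination M 1 1 * h.image + x * hdet
  have f2 : M 0 0 - M 1 0 * ξ = 1 / (M 1 0 * x + M 1 1) := by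
    rw [eq_div_iff hw.ne']
    linear_combination -M 1 0 * h.image + hdet
  have g1 : |a - ξ * c| * M 1 1 ≤ x / (M 1 0 * x + M 1 1) * c := by
    have := hac.le.trans (mul_le_mul_of_nonneg_right (min_le_left _ _) hc.le)
    rwa [div_mul_eq_mul_div, le_div_iff₀ (by positivity)] at this
  have g2 : |a - ξ * c| * (M 1 0 + 1) ≤ 1 / (M 1 0 * x + M 1 1) * c := by
    have := hac.le.trans (mul_le_mul_of_nonneg_right (min_le_right _ _) hc.le)
    rwa [div_mul_eq_mul_div (_ / _), le_div_iff₀ (by positivity)] at this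
  have ha1 : 0 ≤ M 1 1 * a - M 0 1 * c := by
    have : M 1 1 * a - M 0 1 * c = x / (M 1 0 * x + M 1 1) * c + M 1 1 * (a - ξ * c) := by
      rw [← f1]; ring
    rw [this]
    nlinarith [neg_abs_le (a - ξ * c)]
  have hc1 : 0 ≤ M 0 0 * c - M 1 0 * a := by
    have : M 0 0 * c - M 1 0 * a = 1 / (M 1 0 * x + M 1 1) * c - M 1 0 * (a - ξ * c) := by
      rw [← f2]; ring
    rw [this]
    nlinarith [le_abs_self (a - ξ * c), abs_nonneg (a - ξ * c)]
  have ea : a = M 0 0 * (M 1 1 * a - M 0 1 * c) + M 0 1 * (M 0 0 * c - M 1 0 * a) := by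
    linear_combination -a * hdet
  have ec : c = M 1 0 * (M 1 1 * a - M 0 1 * c) + M 1 1 * (M 0 0 * c - M 1 0 * a) := by
    linear_combination -c * hdet
  refine ⟨M 1 1 * a - M 0 1 * c, M 0 0 * c - M 1 0 * a, ⟨?_, ha1, hc1, ?_⟩, ?_⟩
  · have := hL.transform (inv_mem (matrices_le_integralMatrices h.mem))
    convert this using 1 <;> simp [inv_entries] <;> ring
  · by_contra hcon
    have h2 : M 1 1 * a - M 0 1 * c = 0 := by linarith
    have h3 : M 0 0 * c - M 1 0 * a = 0 := by linarith
    rw [h2, h3] at ec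
    simp at ec
    linarith
  · rw [← h.weight_eq, ← ea, ← ec]

/-! ### Lagrange numbers of expansions -/

lemma abs_formA_eq_weight (ξ : ℝ) (g : SL(2, ℝ)) :
    |formA ξ g| = weight ξ 0 (g 0 0) (g 1 0) := by
  simp [formA, weight, abs_mul, mul_comm]

lemma finite_lattice_slopes (R : ℝ) :
    {x : ℝ | ∃ a c : ℝ, IsLattice a c ∧ |a| ≤ R ∧ |c| ≤ R ∧ a / c = x}.Finite := by
  have h3 : (1 : ℝ) ≤ √3 := by linarith [sqrt_three_gt]
  set N : ℤ := ⌈R⌉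
  have hfin := (Set.finite_Icc (-N) N).prod (Set.finite_Icc (-N) N)
  refine ((hfin.image fun z : ℤ × ℤ => (z.1 : ℝ) / (√3 * z.2)).union
    (hfin.image fun z : ℤ × ℤ => (√3 * z.1 : ℝ) / z.2)).subset ?_
  have hint : ∀ m : ℤ, |(m : ℝ)| ≤ R → m ∈ Set.Icc (-N) N := by
    intro m hm
    rw [Set.mem_Icc, ← abs_le]
    exact_mod_cast hm.trans (Int.le_ceil R)
  have hint' : ∀ m : ℤ, |√3 * (m : ℝ)| ≤ R → m ∈ Set.Icc (-N) N := by
    intro m hm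
    rw [abs_mul, abs_of_nonneg (by linarith)] at hm
    exact hint m (by nlinarith [abs_nonneg (m : ℝ)])
  rintro x ⟨a, c, ⟨m, n, ⟨rfl, rfl⟩ | ⟨rfl, rfl⟩⟩, ha, hc, rfl⟩
  · exact Or.inl ⟨(m, n), ⟨hint m ha, hint' n hc⟩, rfl⟩
  · exact Or.inr ⟨(m, n), ⟨hint' m ha, hint n hc⟩, rfl⟩

/-- A real point fixed by a parabolic element of `H_6` is the slope of a lattice vector. -/
lemma exists_isLattice_of_mem_parabolicPoints {ξ : ℝ}
    (h : (ξ : OnePoint ℝ) ∈ parabolicPoints (heckeGroup 6)) :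
    ∃ a c : ℝ, IsLattice a c ∧ 0 < c ∧ a - ξ * c = 0 := by
  obtain ⟨_, ⟨g, hg, rfl⟩, hpar, hfix⟩ := h
  have hgm := matrices_le_integralMatrices hg
  rw [hpar.smul_eq_self_iff, Matrix.GeneralLinearGroup.parabolicFixedPoint] at hfix
  change (ξ : OnePoint ℝ) = if g 1 0 = 0 then OnePoint.infty else
    (((g 0 0 - g 1 1) / (2 * g 1 0) : ℝ) : OnePoint ℝ) at hfix
  split_ifs at hfix with hnot
  · exact absurd hfix (OnePoint.coe_ne_infty _)
  have hroot : (g 0 0 - g 1 1) - ξ * (2 * g 1 0) = 0 := by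
    rw [OnePoint.coe_eq_coe] at hfix
    rw [hfix, div_mul_cancel₀ _ (mul_ne_zero two_ne_zero hnot), sub_self]
  have hL : IsLattice (g 0 0 - g 1 1) (2 * g 1 0) := by
    rcases hgm with ⟨p, q, r, s, h1, h2, h3, h4⟩ | ⟨p, q, r, s, h1, h2, h3, h4⟩
    · exact ⟨p - s, 2 * r, Or.inl (by rw [h1, h3, h4]; push_cast; constructor <;> ring)⟩
    · exact ⟨p - s, 2 * r, Or.inr (by rw [h1, h3, h4]; push_cast; constructor <;> ring)⟩
  rcases lt_or_gt_of_ne hnot with h0 | h0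
  · exact ⟨_, _, hL.neg, by linarith, by linarith⟩
  · exact ⟨_, _, hL, by linarith, hroot⟩

/-- The data of an expansion: blocks `e j ≥ 1`, tails `p j`, and reversed initial segments
`q j`. -/
structure IsExpansion (e : ℕ → ℕ) (p q : ℕ → ℝ) : Prop where
  one_le : ∀ j, 1 ≤ e j
  p_mem : ∀ j, 0 ≤ p j ∧ p j ≤ 2
  p_eq : ∀ j, p j = block (e j) (p (j + 1))
  q_zero : q 0 = 0
  q_eq : ∀ j, q (j + 1) = block (e j) (q j)

lemma IsExpansion.q_mem {e : ℕ → ℕ} {p q : ℕ → ℝ} (h : IsExpansion e p q) (j : ℕ) :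
    0 ≤ q j ∧ q j ≤ 2 := by
  induction j with
  | zero => rw [h.q_zero]; norm_num
  | succ j ih => rw [h.q_eq]; exact ⟨(block_mem _ ih.1).1.le, (block_mem _ ih.1).2⟩

section
variable {e : ℕ → ℕ} {p q : ℕ → ℝ} (h : IsExpansion e p q)
include h

/-- If the heights are eventually at most `1 / B`, then all lattice vectors of slope sufficiently
close to `ξ` have weight at least `B`. -/
lemma IsExpansion.exists_le_weight {B : ℝ} (hB0 : 0 ≤ B) (hB : B * 2.26 ≤ 1)
    (hup : ∀ᶠ j in Filter.atTop, B * height (p j) (q j) ≤ 1 ∧ B * height (q j) (p j) ≤ 1) :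
    ∃ η > 0, ∀ a c : ℝ, IsLattice a c → 0 < c → |a - three.act (p 0) * c| < η * c →
      B ≤ weight (three.act (p 0)) 0 a c := by
  obtain ⟨J, hJ⟩ := Filter.eventually_atTop.mp hup
  obtain ⟨M, hM⟩ := exists_carries (fun j => (h.p_mem j).1) h.p_eq h.q_zero h.q_eq (J + 1)
  obtain ⟨η, hη, hcone⟩ := hM.exists_isConeVector (three.act_pos (h.p_mem _).1)
  refine ⟨η, hη, fun a c hL hc hac => ?_⟩
  obtain ⟨a', c', hv, hw⟩ := hcone a c hL hc hac
  rw [← hw]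
  exact le_weight_of_height_le h.one_le (fun j => (h.p_mem j).1) h.p_eq (fun j => (h.q_mem j).1)
    h.q_eq hB0 hB (Nat.le_add_left 1 J) (fun j hj => hJ j (by omega)) hv

/-- The value `ξ` of an expansion is not a cusp: otherwise it would be the slope of a lattice vector,
of weight `0`. -/
lemma IsExpansion.not_mem_parabolicPoints {B : ℝ} (hB0 : 0 < B) (hB : B * 2.26 ≤ 1)
    (hup : ∀ᶠ j in Filter.atTop, B * height (p j) (q j) ≤ 1 ∧ B * height (q j) (p j) ≤ 1) :
    ((three.act (p 0) : ℝ) : OnePoint ℝ) ∉ parabolicPoints (heckeGroup 6) := by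
  intro hmem
  obtain ⟨a, c, hL, hc, hac⟩ := exists_isLattice_of_mem_parabolicPoints hmem
  obtain ⟨η, hη, hw⟩ := h.exists_le_weight hB0.le hB hup
  have := hw a c hL hc (by rw [hac, abs_zero]; positivity)
  rw [weight, hac] at this
  simp at this
  linarith

/-- All but finitely many cusps have weight at least `B`. -/
lemma IsExpansion.eventually_le_weight {B : ℝ} (hB0 : 0 ≤ B) (hB : B * 2.26 ≤ 1)
    (hup : ∀ᶠ j in Filter.atTop, B * height (p j) (q j) ≤ 1 ∧ B * height (q j) (p j) ≤ 1) :
    ∀ᶠ g in Filter.comap (fun g : matrices (heckeGroup 6) => imageOfInfty g.1) Filter.cofinite,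
      B ≤ |formA (three.act (p 0)) g.1| := by
  obtain ⟨η, hη, hw⟩ := h.exists_le_weight hB0 hB hup
  set ξ := three.act (p 0) with hξ
  have hξ0 : 0 < ξ := three.act_pos (h.p_mem 0).1
  set R := (ξ + 1) / η + 1
  have hfin : (insert OnePoint.infty ((fun x : ℝ => (x : OnePoint ℝ)) '' {x : ℝ | ∃ a c : ℝ,
      IsLattice a c ∧ |a| ≤ R ∧ |c| ≤ R ∧ a / c = x})).Finite :=
    ((finite_lattice_slopes R).image _).insert _
  refine Filter.mem_of_superset (Filter.preimage_mem_comap hfin.compl_mem_cofinite) ?_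
  intro g hg
  simp only [Set.mem_preimage, Set.mem_compl_iff, Set.mem_insert_iff, not_or] at hg
  obtain ⟨hg1, hg2⟩ := hg
  rw [imageOfInfty_eq] at hg1 hg2
  have hc0 : g.1 1 0 ≠ 0 := by
    intro h0; exact hg1 (by rw [if_pos h0])
  rw [if_neg hc0] at hg2
  have hL := isLattice_column (matrices_le_integralMatrices g.2)
  -- A lattice vector of small weight whose slope is not close to `ξ` has bounded coordinates.
  have key : ∀ a c : ℝ, IsLattice a c → 0 < c → a / c = g.1 0 0 / g.1 1 0 →
      B ≤ weight ξ 0 a c := by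
    intro a c hL hc hac
    by_contra hlt
    push Not at hlt
    have hfar : η * c ≤ |a - ξ * c| := by
      by_contra hnear
      push Not at hnear
      exact absurd (hw a c hL hc hnear) (not_le.mpr hlt)
    have hc1 := hL.one_le_right hc
    have hwt : weight ξ 0 a c = |a - ξ * c| * c := by
      simp [weight, abs_of_pos hc]
    have h1 : |a - ξ * c| < 1 := by
      rw [hwt] at hlt
      nlinarith [abs_nonneg (a - ξ * c)]
    have hc2 : c ≤ 1 / η := by
      rw [le_div_iff₀ hη]; linarith
    have ha2 : |a| ≤ ξ * (1 / η) + 1 := by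
      have : |a| ≤ |a - ξ * c| + |ξ * c| := by
        have := abs_add_le (a - ξ * c) (ξ * c)
        rwa [sub_add_cancel] at this
      rw [abs_of_pos (by positivity : 0 < ξ * c)] at this
      nlinarith
    have hη' : 0 < 1 / η := by positivity
    have hR : R = ξ * (1 / η) + 1 / η + 1 := by simp only [R]; ring
    refine hg2 ⟨a / c, ⟨a, c, hL, by linarith, ?_, rfl⟩, by simp only [hac]⟩
    rw [abs_of_pos hc]
    nlinarith
  rw [Set.mem_ofPred_eq, abs_formA_eq_weight]
  rcases hc0.lt_or_gt with h0 | h0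
  · rw [← weight_neg]
    exact key _ _ hL.neg (by linarith) (neg_div_neg_eq _ _)
  · exact key _ _ hL h0 rfl

/-- The convergents that stop after the digit `3` of a block have as weights the inverses of the
heights, and their denominators tend to infinity. -/
lemma IsExpansion.exists_convergent (j : ℕ) : ∃ g : matrices (heckeGroup 6),
    |formA (three.act (p 0)) g.1| * height (p j) (q j) = 1 ∧ (j : ℝ) ≤ g.1 1 0 := by
  obtain ⟨M, hM⟩ := exists_carries (fun j => (h.p_mem j).1) h.p_eq h.q_zero h.q_eq j
  have hp0 := (h.p_mem j).1
  have h1 := hM.digit three_mat_mem hp0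
  refine ⟨⟨_, h1.mem⟩, ?_, ?_⟩
  · have hq' : 0 < three.act (q j) := three.act_pos (h.q_mem j).1
    have hflip : three.flip.act (q j) = three.act (q j) := rfl
    have h2 := h1.weight_eq 1 0
    rw [hflip] at h2
    simp only [mul_one, mul_zero, add_zero] at h2
    rw [abs_formA_eq_weight, h2, height]
    simp only [weight, mul_one, mul_zero, add_zero, sub_zero, abs_one, one_mul, abs_of_pos hq']
    generalize three.act (q j) = u at *
    field_simp
  · have h2 := hM.le_add
    have h3 := hM.nonneg
    have h4 := hM.one_le
    have h5 : (M * three.mat) 1 0 = M 1 0 * three.s + M 1 1 * three.r := by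
      rw [mul_entry]; rfl
    simp only [h5]
    nlinarith [three.one_le_s, three.one_le_r]

/-- Heights that are at least `v` infinitely often give infinitely many cusps: the convergents tend
to `ξ` without being equal to it. -/
lemma IsExpansion.frequently_le {v : ℝ}
    (hlow : ∃ᶠ j in Filter.atTop, v ≤ height (p j) (q j)) :
    ∃ᶠ g in Filter.comap (fun g : matrices (heckeGroup 6) => imageOfInfty g.1) Filter.cofinite,
      ENNReal.ofReal v ≤ (ENNReal.ofReal |formA (three.act (p 0)) g.1|)⁻¹ := by
  set ξ := three.act (p 0) with hξ
  rw [Filter.frequently_comap, Filter.frequently_cofinite_iff_infinite]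
  intro hfin
  have hfin' := (hfin.preimage (f := fun x : ℝ => (x : OnePoint ℝ))
    (OnePoint.coe_injective.injOn)).subset (Set.sdiff_subset (t := {ξ}))
  obtain ⟨r, hr, hball⟩ := Metric.isOpen_iff.mp hfin'.isClosed.isOpen_compl ξ (by simp)
  obtain ⟨n, hn⟩ := exists_nat_gt (2 / r)
  obtain ⟨j, hj, hjn⟩ := (hlow.and_eventually (Filter.eventually_ge_atTop (n + 1))).exists
  obtain ⟨g, hg, hgc⟩ := h.exists_convergent j
  have hjn' : (n : ℝ) + 1 ≤ j := by exact_mod_cast hjn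
  have hn0 : (0 : ℝ) ≤ n := n.cast_nonneg
  have hc : 1 ≤ g.1 1 0 := by linarith
  have hheight : 1 / 2 ≤ height (p j) (q j) := by
    have h1 := three.act_le_two (h.q_mem j).1
    have h2 := three.act_pos (h.q_mem j).1
    have : 1 / 2 ≤ 1 / three.act (q j) := by gcongr
    rw [height]
    linarith [(h.p_mem j).1]
  have hA0 : 0 < |formA ξ g.1| := by
    by_contra h0
    have : |formA ξ g.1| = 0 := le_antisymm (not_lt.mp h0) (abs_nonneg _)
    rw [this] at hg
    simp at hg
  have hA2 : |formA ξ g.1| ≤ 2 := by nlinarith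
  have hdist := sq_mul_abs_sub_div ξ (g.1 0 0) (g.1 1 0)
  change _ = |formA ξ g.1| at hdist
  have him : imageOfInfty g.1 = ((g.1 0 0 / g.1 1 0 : ℝ) : OnePoint ℝ) := by
    rw [imageOfInfty_eq, if_neg (by linarith)]
  refine hball (a := g.1 0 0 / g.1 1 0) ?_ ⟨⟨g, him, ?_⟩, ?_⟩
  · rw [Metric.mem_ball, dist_comm, Real.dist_eq]
    rw [div_lt_iff₀ hr] at hn
    have h1 : g.1 1 0 * |ξ - g.1 0 0 / g.1 1 0| ≤ g.1 1 0 ^ 2 * |ξ - g.1 0 0 / g.1 1 0| := by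
      gcongr
      nlinarith
    have h2 : (n : ℝ) * |ξ - g.1 0 0 / g.1 1 0| ≤ g.1 1 0 * |ξ - g.1 0 0 / g.1 1 0| := by
      gcongr
      linarith
    have h3 : (n : ℝ) * |ξ - g.1 0 0 / g.1 1 0| < n * r := by linarith
    exact lt_of_mul_lt_mul_left h3 hn0
  · rw [← ENNReal.ofReal_inv_of_pos hA0]
    refine ENNReal.ofReal_le_ofReal (hj.trans ?_)
    rw [eq_inv_of_mul_eq_one_right hg]
  · rintro heq
    simp only [Set.mem_singleton_iff] at heq
    rw [heq] at hdist
    simp at hdist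
    rw [hdist] at hA0
    simp at hA0

/-- The Lagrange number of an expansion is the limit superior of its heights. -/
lemma IsExpansion.lagrangeNumber_eq {V : ℝ} (hV : 2.26 ≤ V)
    (hup : ∀ δ > 0, ∀ᶠ j in Filter.atTop, height (p j) (q j) ≤ V + δ ∧ height (q j) (p j) ≤ V + δ)
    (hlow : ∀ δ > 0, ∃ᶠ j in Filter.atTop, V - δ ≤ height (p j) (q j)) :
    ((three.act (p 0) : ℝ) : OnePoint ℝ) ∉ parabolicPoints (heckeGroup 6) ∧
      lagrangeNumber (heckeGroup 6) (three.act (p 0)) = ENNReal.ofReal V := by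
  have hup' : ∀ δ > 0, 0 < (V + δ)⁻¹ ∧ (V + δ)⁻¹ * 2.26 ≤ 1 ∧ ∀ᶠ j in Filter.atTop,
      (V + δ)⁻¹ * height (p j) (q j) ≤ 1 ∧ (V + δ)⁻¹ * height (q j) (p j) ≤ 1 := by
    intro δ hδ
    have hpos : 0 < V + δ := by linarith
    refine ⟨by positivity, by rw [inv_mul_le_iff₀ hpos]; linarith, (hup δ hδ).mono fun j hj => ?_⟩
    rw [inv_mul_le_iff₀ hpos, inv_mul_le_iff₀ hpos, mul_one]
    exact hj
  have hpar : ((three.act (p 0) : ℝ) : OnePoint ℝ) ∉ parabolicPoints (heckeGroup 6) := by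
    obtain ⟨h1, h2, h3⟩ := hup' 1 one_pos
    exact h.not_mem_parabolicPoints h1 h2 h3
  refine ⟨hpar, ?_⟩
  rw [HeckeSpectra.lagrangeNumber_eq]
  set ξ := three.act (p 0) with hξ
  apply le_antisymm
  · refine ENNReal.le_of_forall_pos_le_add fun δ hδ _ => ?_
    obtain ⟨h1, h2, h3⟩ := hup' δ hδ
    refine Filter.limsup_le_of_le (h := ?_)
    filter_upwards [h.eventually_le_weight h1.le h2 h3] with g hg
    rw [← ENNReal.ofReal_coe_nnreal (p := δ), ← ENNReal.ofReal_add (by linarith) δ.coe_nonneg,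
      ENNReal.inv_le_iff_inv_le, ← ENNReal.ofReal_inv_of_pos (by positivity)]
    exact ENNReal.ofReal_le_ofReal hg
  · refine ENNReal.le_of_forall_pos_le_add fun δ hδ _ => ?_
    have hle : ENNReal.ofReal (V - δ) ≤ Filter.limsup (fun g : matrices (heckeGroup 6) =>
        (ENNReal.ofReal |formA ξ g.1|)⁻¹)
        (Filter.comap (fun g : matrices (heckeGroup 6) => imageOfInfty g.1) Filter.cofinite) :=
      Filter.le_limsup_of_frequently_le (h.frequently_le (hlow δ hδ))
    calc ENNReal.ofReal V = ENNReal.ofReal (V - δ + δ) := by rw [sub_add_cancel]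
      _ ≤ ENNReal.ofReal (V - δ) + ENNReal.ofReal δ := ENNReal.ofReal_add_le
      _ ≤ _ := by rw [ENNReal.ofReal_coe_nnreal]; gcongr

end

/-! ### Sequences of blocks with prescribed Lagrange number -/

/-- The exponents of the blocks, coded by a sequence `b` of bits. Every square `m ^ 2 ≥ 1` carries
the largest exponent `n + 3`, and is preceded by the smallest one `n`. It is followed by the first
`m - 1` bits, coded by the exponents `n + 1` and `n + 2`, and all other exponents are `n + 1`. -/
def exponents (n : ℕ) (b : ℕ → Fin 2) (j : ℕ) : ℕ :=
  let s := j.sqrt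
  let i := j - s * s
  if i = 2 * s then n else if i = 0 then n + 3 else if i < s then n + 1 + b (i - 1) else n + 1

lemma exponents_add (n : ℕ) (b : ℕ → Fin 2) {s i : ℕ} (h : i ≤ 2 * s) :
    exponents n b (s * s + i) = if i = 2 * s then n else if i = 0 then n + 3 else
      if i < s then n + 1 + b (i - 1) else n + 1 := by
  have hs : (s * s + i).sqrt = s := Nat.sqrt_add_eq s (by omega)
  simp only [exponents, hs, Nat.add_sub_cancel_left]

lemma exists_eq_mul_self_add (j : ℕ) : ∃ s i, i ≤ 2 * s ∧ j = s * s + i := by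
  refine ⟨j.sqrt, j - j.sqrt * j.sqrt, ?_, ?_⟩
  · have := Nat.sqrt_le_add j
    omega
  · have := Nat.sqrt_le j
    omega

variable (n : ℕ) (b : ℕ → Fin 2)

lemma exponents_mem (j : ℕ) : n ≤ exponents n b j ∧ exponents n b j ≤ n + 3 := by
  obtain ⟨s, i, h, rfl⟩ := exists_eq_mul_self_add j
  rw [exponents_add n b h]
  have := (b (i - 1)).isLt
  split_ifs <;> omega

lemma exponents_square (k : ℕ) : exponents n b ((k + 1) * (k + 1)) = n + 3 := by
  rw [← add_zero ((k + 1) * (k + 1)), exponents_add n b (Nat.zero_le _), if_neg (by omega),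
    if_pos rfl]

lemma exponents_square_sub_one (k : ℕ) : exponents n b ((k + 1) * (k + 1) - 1) = n := by
  have : (k + 1) * (k + 1) - 1 = k * k + 2 * k := by
    have : (k + 1) * (k + 1) = k * k + 2 * k + 1 := by ring
    omega
  rw [this, exponents_add n b le_rfl, if_pos rfl]

lemma exponents_square_add {k i : ℕ} (hi : i < k) :
    exponents n b ((k + 1) * (k + 1) + 1 + i) = n + 1 + b i := by
  rw [add_assoc, exponents_add n b (by omega), if_neg (by omega), if_neg (by omega),
    if_pos (by omega), Nat.add_sub_cancel_left]

lemma exponents_square_sub {k i : ℕ} (hi : i < k) :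
    exponents n b ((k + 1) * (k + 1) - 2 - i) = n + 1 := by
  have : (k + 1) * (k + 1) - 2 - i = k * k + (2 * k - 1 - i) := by
    have : (k + 1) * (k + 1) = k * k + 2 * k + 1 := by ring
    omega
  rw [this, exponents_add n b (by omega), if_neg (by omega), if_neg (by omega),
    if_neg (by omega)]

lemma eq_square_of_exponents_eq {j : ℕ} (h : exponents n b j = n + 3) :
    ∃ k, j = (k + 1) * (k + 1) := by
  obtain ⟨s, i, hi, rfl⟩ := exists_eq_mul_self_add j
  rw [exponents_add n b hi] at h
  have := (b (i - 1)).isLt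
  split_ifs at h with h1 h2 h3
  · omega
  · obtain ⟨k, rfl⟩ : ∃ k, s = k + 1 := ⟨s - 1, by omega⟩
    exact ⟨k, by rw [h2, add_zero]⟩
  · omega
  · omega

lemma succ_eq_square_of_exponents_eq {j : ℕ} (h : exponents n b j = n) :
    ∃ k, j + 1 = (k + 1) * (k + 1) := by
  obtain ⟨s, i, hi, rfl⟩ := exists_eq_mul_self_add j
  rw [exponents_add n b hi] at h
  split_ifs at h with h1 h2 h3
  · exact ⟨s, by rw [h1]; ring⟩
  all_goals omega

/-- The tails of the expansion with exponents `e`. -/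
noncomputable def tail (e : ℕ → ℕ) (j : ℕ) : ℝ := expansion fun i => e (j + i)

/-- The initial segments of the expansion with exponents `e`, read backwards. -/
noncomputable def past (e : ℕ → ℕ) : ℕ → ℝ
  | 0 => 0
  | j + 1 => block (e j) (past e j)

lemma isExpansion {e : ℕ → ℕ} (he : ∀ j, 1 ≤ e j) : IsExpansion e (tail e) (past e) where
  one_le := he
  p_mem j := ⟨expansion_nonneg _, expansion_le_two _⟩
  p_eq j := by
    simp only [tail]
    rw [expansion_eq, add_zero]
    congr 2
    funext i
    congr 1
    ring
  q_zero := rfl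
  q_eq _ := rfl

/-- The limit of the tails of the expansion at the squares. -/
noncomputable def futureLimit (n : ℕ) (b : ℕ → Fin 2) : ℝ :=
  block (n + 3) (expansion fun i => n + 1 + b i)

/-- The limit of the reversed initial segments of the expansion at the squares. -/
noncomputable def pastLimit (n : ℕ) : ℝ := block n (expansion fun _ => n + 1)

lemma pastLimit_mem : 0 < pastLimit n ∧ pastLimit n ≤ 2 := block_mem _ (expansion_nonneg _)

variable {n} (hn : 1 ≤ n)
include hn

lemma isExpansion_exponents :
    IsExpansion (exponents n b) (tail (exponents n b)) (past (exponents n b)) :=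
  isExpansion fun j => hn.trans (exponents_mem n b j).1

lemma abs_tail_sub_futureLimit_le (k : ℕ) :
    |tail (exponents n b) ((k + 1) * (k + 1)) - futureLimit n b| ≤ 2 / 3 ^ k := by
  have hE := isExpansion_exponents b hn
  set p := tail (exponents n b)
  have h1 := abs_sub_le_of_eq_block k (x := fun i => p ((k + 1) * (k + 1) + 1 + i))
    (y := fun i => expansion fun m => n + 1 + b (m + i)) (a := fun i => n + 1 + b i)
    (fun i => hE.p_mem _) (fun i => ⟨expansion_nonneg _, expansion_le_two _⟩)
    (fun i hi => by
      rw [hE.p_eq, exponents_square_add n b hi, add_assoc _ i 1])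
    (fun i hi => by
      rw [expansion_eq, zero_add]
      congr 2
      funext m
      congr 3
      ring)
  simp only [add_zero] at h1
  rw [hE.p_eq, exponents_square, futureLimit]
  refine (abs_block_sub_block_le _ (hE.p_mem _).1 (expansion_nonneg _)).trans ?_
  exact (div_le_self (abs_nonneg _) (by norm_num)).trans h1

lemma abs_past_sub_pastLimit_le (k : ℕ) :
    |past (exponents n b) ((k + 1) * (k + 1)) - pastLimit n| ≤ 2 / 3 ^ k := by
  have hE := isExpansion_exponents b hn
  have ht : k + 1 ≤ (k + 1) * (k + 1) := Nat.le_mul_self _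
  have h1 := abs_sub_le_of_eq_block k
    (x := fun i => past (exponents n b) ((k + 1) * (k + 1) - 1 - i))
    (y := fun _ => expansion fun _ => n + 1) (a := fun _ => n + 1)
    (fun i => hE.q_mem _) (fun i => ⟨expansion_nonneg _, expansion_le_two _⟩)
    (fun i hi => by
      rw [show (k + 1) * (k + 1) - 1 - i = ((k + 1) * (k + 1) - 2 - i) + 1 by omega, hE.q_eq,
        exponents_square_sub n b hi]
      congr 2
      omega)
    (fun i hi => expansion_eq _)
  simp only [Nat.sub_zero] at h1
  have h2 : past (exponents n b) ((k + 1) * (k + 1)) =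
      block n (past (exponents n b) ((k + 1) * (k + 1) - 1)) := by
    conv_lhs => rw [show (k + 1) * (k + 1) = ((k + 1) * (k + 1) - 1) + 1 by omega]
    rw [hE.q_eq, exponents_square_sub_one]
  rw [h2, pastLimit]
  refine (abs_block_sub_block_le _ (hE.q_mem _).1 (expansion_nonneg _)).trans ?_
  exact (div_le_self (abs_nonneg _) (by norm_num)).trans h1

/-- The tails and the reversed initial segments are all but exponentially close to the interval
from `pastLimit` to `futureLimit`. -/
lemma tail_past_bounds {K j : ℕ} (hj : (K + 1) * (K + 1) < j) :
    (pastLimit n - 2 / 3 ^ K ≤ tail (exponents n b) j ∧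
      tail (exponents n b) j ≤ futureLimit n b + 2 / 3 ^ K) ∧
    (pastLimit n - 2 / 3 ^ K ≤ past (exponents n b) j ∧
      past (exponents n b) j ≤ futureLimit n b + 2 / 3 ^ K) := by
  have hE := isExpansion_exponents b hn
  have hδ : (0 : ℝ) ≤ 2 / 3 ^ K := by positivity
  have hmem := exponents_mem n b
  have hle : ∀ k, (K + 1) * (K + 1) < (k + 1) * (k + 1) → (2 : ℝ) / 3 ^ k ≤ 2 / 3 ^ K := by
    intro k hk
    have : K + 1 < k + 1 := Nat.mul_self_lt_mul_self_iff.mp hk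
    gcongr
    · norm_num
    · omega
  have hb : ∀ i, ((b i : ℕ)) ≤ 1 := fun i => by have := (b i).isLt; omega
  obtain ⟨i, rfl⟩ : ∃ i, j = i + 1 := ⟨j - 1, by omega⟩
  refine ⟨⟨?_, ?_⟩, ⟨?_, ?_⟩⟩
  · have : pastLimit n < tail (exponents n b) (i + 1) := by
      rw [hE.p_eq, pastLimit]
      rcases (hmem (i + 1)).1.eq_or_lt with h | h
      · rw [← h]
        obtain ⟨k, hk⟩ := succ_eq_square_of_exponents_eq n b h.symm
        refine block_lt_block _ (expansion_nonneg _) ?_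
        rw [expansion_eq, hE.p_eq, hk, exponents_square]
        exact block_lt_block_of_lt (by omega) (expansion_nonneg _) (hE.p_mem _).1
      · exact block_lt_block_of_lt h (expansion_nonneg _) (hE.p_mem _).1
    linarith
  · rcases (hmem (i + 1)).2.eq_or_lt with h | h
    · obtain ⟨k, hk⟩ := eq_square_of_exponents_eq n b h
      rw [hk] at hj ⊢
      have h1 := abs_tail_sub_futureLimit_le b hn k
      have h2 := hle k hj
      linarith [le_abs_self (tail (exponents n b) ((k + 1) * (k + 1)) - futureLimit n b)]
    · have : tail (exponents n b) (i + 1) < futureLimit n b := by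
        rw [hE.p_eq, futureLimit]
        exact block_lt_block_of_lt h (hE.p_mem _).1 (expansion_nonneg _)
      linarith
  · rcases (hmem i).1.eq_or_lt with h | h
    · obtain ⟨k, hk⟩ := succ_eq_square_of_exponents_eq n b h.symm
      rw [hk] at hj ⊢
      have h1 := abs_past_sub_pastLimit_le b hn k
      have h2 := hle k hj
      linarith [neg_abs_le (past (exponents n b) ((k + 1) * (k + 1)) - pastLimit n)]
    · have : pastLimit n < past (exponents n b) (i + 1) := by
        rw [hE.q_eq, pastLimit]
        exact block_lt_block_of_lt h (expansion_nonneg _) (hE.q_mem _).1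
      linarith
  · have : past (exponents n b) (i + 1) < futureLimit n b := by
      rw [hE.q_eq, futureLimit]
      rcases (hmem i).2.eq_or_lt with h | h
      · rw [h]
        obtain ⟨k, hk⟩ := eq_square_of_exponents_eq n b h
        refine block_lt_block _ (hE.q_mem _).1 ?_
        have h1 : 1 ≤ (k + 1) * (k + 1) := Nat.one_le_iff_ne_zero.mpr (by positivity)
        rw [hk, show (k + 1) * (k + 1) = ((k + 1) * (k + 1) - 1) + 1 by omega, hE.q_eq,
          exponents_square_sub_one, expansion_eq]
        exact block_lt_block_of_lt (by omega) (hE.q_mem _).1 (expansion_nonneg _)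
      · exact block_lt_block_of_lt h (hE.q_mem _).1 (expansion_nonneg _)
    linarith

omit hn in
/-- `height` increases with its first argument, decreases with the second one, and is Lipschitz. -/
lemma height_le_height_add {p q P Q δ : ℝ} (hq : 0 ≤ q) (hQ : 0 ≤ Q) (hδ : 0 ≤ δ)
    (hp : p ≤ P + δ) (hqQ : Q - δ ≤ q) : height p q ≤ height P Q + 2 * δ := by
  have h3 := sqrt_three_gt
  have hq1 := (three_act_mem hq).1
  have hQ1 := (three_act_mem hQ).1
  have h1 : three.act Q - δ / 3 ≤ three.act q := by
    rcases le_total Q q with h | h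
    · linarith [three.act_le_act hQ h]
    · have h2 := three.abs_act_sub_act_le hQ hq
      rw [abs_of_nonneg (by linarith : 0 ≤ Q - q)] at h2
      linarith [le_abs_self (three.act Q - three.act q)]
  have h2 : 1 / three.act q ≤ 1 / three.act Q + δ := by
    have hpq : 0 < three.act q := three.act_pos hq
    have hpQ : 0 < three.act Q := three.act_pos hQ
    have h4 : 1 / three.act q - 1 / three.act Q =
        (three.act Q - three.act q) / (three.act q * three.act Q) := by
      field_simp
    have h5 : (three.act Q - three.act q) / (three.act q * three.act Q) ≤ δ := by
      rw [div_le_iff₀ (by positivity)]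
      have : 1 / 3 ≤ three.act q * three.act Q := by nlinarith
      nlinarith
    linarith
  rw [height, height]
  linarith

/-- The Lagrange number attained by the expansion that is coded by `b`. -/
noncomputable def codedHeight (n : ℕ) (b : ℕ → Fin 2) : ℝ := height (futureLimit n b) (pastLimit n)

/-- The widths at the squares tend to `codedHeight n b`, and all others are eventually not much
larger. -/
lemma ofReal_codedHeight_mem (hV : 2.26 ≤ codedHeight n b) :
    ENNReal.ofReal (codedHeight n b) ∈ lagrangeSpectrum (heckeGroup 6) := by
  have hE := isExpansion_exponents b hn
  have hsmall : ∀ δ > 0, ∃ K : ℕ, (2 : ℝ) * (2 / 3 ^ K) < δ := by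
    intro δ hδ
    obtain ⟨K, hK⟩ := exists_pow_lt_of_lt_one (by positivity : 0 < δ / 4)
      (by norm_num : (1 / 3 : ℝ) < 1)
    refine ⟨K, ?_⟩
    rw [div_pow, one_pow] at hK
    have : (2 : ℝ) * (2 / 3 ^ K) = 4 * (1 / 3 ^ K) := by ring
    linarith
  refine ⟨three.act (tail (exponents n b) 0), hE.lagrangeNumber_eq hV ?_ ?_⟩
  · intro δ hδ
    obtain ⟨K, hK⟩ := hsmall δ hδ
    filter_upwards [Filter.eventually_gt_atTop ((K + 1) * (K + 1))] with j hj
    obtain ⟨⟨h1, h2⟩, h3, h4⟩ := tail_past_bounds b hn hj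
    have hδ : (0 : ℝ) ≤ 2 / 3 ^ K := by positivity
    have h5 := height_le_height_add (hE.q_mem j).1 (pastLimit_mem n).1.le hδ h2 h3
    have h6 := height_le_height_add (hE.p_mem j).1 (pastLimit_mem n).1.le hδ h4 h1
    rw [codedHeight]
    constructor <;> linarith
  · intro δ hδ
    obtain ⟨K, hK⟩ := hsmall δ hδ
    refine Filter.frequently_atTop.mpr fun N => ?_
    set k := max K N
    refine ⟨(k + 1) * (k + 1), ?_, ?_⟩
    · have : k + 1 ≤ (k + 1) * (k + 1) := Nat.le_mul_self _
      have := le_max_right K N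
      omega
    · have h1 := abs_le.mp (abs_tail_sub_futureLimit_le b hn k)
      have h2 := abs_le.mp (abs_past_sub_pastLimit_le b hn k)
      have hk : (2 : ℝ) / 3 ^ k ≤ 2 / 3 ^ K := by
        gcongr
        · norm_num
        · exact le_max_left K N
      have h3 := height_le_height_add (p := futureLimit n b) (q := pastLimit n)
        (P := tail (exponents n b) ((k + 1) * (k + 1)))
        (Q := past (exponents n b) ((k + 1) * (k + 1))) (δ := 2 / 3 ^ k) (pastLimit_mem n).1.le
        (hE.q_mem _).1 (by positivity) (by linarith [h1.1]) (by linarith [h2.2])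
      rw [codedHeight]
      linarith

omit hn

/-! ### The accumulation point `4/√3` -/

/-- The periodic expansion `4, 2, 4, 2, …` as future and as past gives the height `4 / √3`. -/
lemma exists_pair_fixed : ∃ P : ℝ, 0 < P ∧ P ≤ 2 ∧ pair P = P ∧ height P P = 4 / √3 := by
  have h3 := sqrt_three_gt
  have h3' := sqrt_three_lt
  have h33 := sqrt_three_mul_self
  have h39 : √39 * √39 = (39 : ℝ) := Real.mul_self_sqrt (by norm_num)
  have h39' : √39 < 7 := by rw [Real.sqrt_lt' (by norm_num)]; norm_num
  have h39p : (0 : ℝ) < √39 := by positivity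
  set P : ℝ := (√3 + √39) / 6 with hP
  have hP0 : 0 < P := by positivity
  have hPeq : √3 * P ^ 2 = P + √3 := by
    rw [hP]
    linear_combination (√3 / 36) * h39 + ((√3 + 2 * √39) / 36) * h33
  have htwo : two.act P = P⁻¹ := by
    have h : two.act P * (2 * P + √3) = √3 * P + 1 := two.act_mul_denom hP0.le
    refine eq_inv_of_mul_eq_one_left (mul_left_cancel₀ (b := two.act P * P)
      (by positivity : 2 * P + √3 ≠ 0) ?_)
    linear_combination P * h + hPeq
  refine ⟨P, hP0, by linarith, ?_, ?_⟩
  · have h := two.flip_act_mul_act hP0 (mul_inv_cancel₀ hP0.ne')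
    change four.act P⁻¹ * two.act P = 1 at h
    rw [htwo] at h
    rw [pair, htwo]
    exact (mul_inv_eq_one₀ hP0.ne').mp h
  · have h : three.act P * (√3 * P + 2) = 2 * P + √3 := three.act_mul_denom hP0.le
    have hpos := three.act_pos hP0.le
    have h1 : 1 / three.act P = (√3 * P + 2) / (2 * P + √3) := by
      rw [div_eq_div_iff hpos.ne' (by positivity)]
      linarith
    have h2 : P + (√3 * P + 2) / (2 * P + √3) =
        (P * (2 * P + √3) + (√3 * P + 2)) / (2 * P + √3) := by
      field_simp
    rw [height, h1, h2, div_eq_div_iff (by positivity) (by positivity)]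
    linear_combination 2 * hPeq + 2 * P * h33

lemma abs_codedHeight_sub_le (n : ℕ) (b : ℕ → Fin 2) :
    |codedHeight n b - 4 / √3| ≤ 4 / 3 ^ n := by
  obtain ⟨P, hP0, hP2, hfix, hheight⟩ := exists_pair_fixed
  have key : ∀ (m : ℕ) (x : ℝ), n ≤ m → 0 ≤ x → |block m x - P| ≤ 2 / 3 ^ n := by
    intro m x hm hx
    have h1 := abs_iterate_pair_sub_le m (three.act_pos hx) (three.act_le_two hx) hP0 hP2
    rw [Function.iterate_fixed hfix] at h1
    refine h1.trans ?_
    have h2 : |three.act x - P| ≤ 2 := by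
      have := three.act_pos hx
      have := three.act_le_two hx
      rw [abs_le]; constructor <;> linarith
    gcongr
    norm_num
  have h1 := abs_le.mp (key (n + 3) _ (by omega) (expansion_nonneg fun i => n + 1 + b i))
  have h2 := abs_le.mp (key n _ le_rfl (expansion_nonneg fun _ => n + 1))
  change _ ≤ futureLimit n b - P ∧ futureLimit n b - P ≤ _ at h1
  change _ ≤ pastLimit n - P ∧ pastLimit n - P ≤ _ at h2
  have hδ : (0 : ℝ) ≤ 2 / 3 ^ n := by positivity
  have h3 := height_le_height_add (p := futureLimit n b) (q := pastLimit n) (P := P) (Q := P)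
    (pastLimit_mem n).1.le hP0.le hδ (by linarith) (by linarith)
  have h4 := height_le_height_add (p := P) (q := P) (P := futureLimit n b) (Q := pastLimit n)
    hP0.le (pastLimit_mem n).1.le hδ (by linarith) (by linarith)
  have h5 : (4 : ℝ) / 3 ^ n = 2 * (2 / 3 ^ n) := by ring
  rw [← hheight, codedHeight, h5, abs_le]
  constructor <;> linarith

/-! ### Hausdorff dimension -/

/-- Expansions coded by sequences of bits that first differ at `k` are at least exponentially far
apart. -/
lemma le_abs_expansion_sub (n : ℕ) {x y : ℕ → Fin 2} {k : ℕ} (hlt : ∀ i < k, x i = y i)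
    (hk : x k ≠ y k) : 1 / 10 * (1 / 36 ^ (2 * n + 7)) ^ (k + 1) ≤
      |(expansion fun i => n + 1 + x i) - expansion fun i => n + 1 + y i| := by
  induction k generalizing x y with
  | zero =>
    have main : ∀ x y : ℕ → Fin 2, x 0 = 0 → y 0 = 1 →
        1 / 10 * (1 / 36 ^ (2 * n + 7)) ^ (0 + 1) ≤
          |(expansion fun i => n + 1 + y i) - expansion fun i => n + 1 + x i| := by
      intro x y hx hy
      rw [expansion_eq (fun i => n + 1 + y i), expansion_eq (fun i => n + 1 + x i), hx, hy]
      have h := le_block_succ_sub_block (n + 1)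
        (expansion_nonneg fun i => n + 1 + x (i + 1)) (expansion_le_two _)
        (expansion_nonneg fun i => n + 1 + y (i + 1))
      refine le_trans ?_ h
      rw [zero_add, pow_one, mul_one_div]
      gcongr
      · norm_num
      · omega
    have hx : x 0 = 0 ∨ x 0 = 1 := by omega
    have hy : y 0 = 0 ∨ y 0 = 1 := by omega
    rcases hx with hx | hx <;> rcases hy with hy | hy
    · exact absurd (hx.trans hy.symm) hk
    · rw [abs_sub_comm]; exact main x y hx hy
    · exact main y x hy hx
    · exact absurd (hx.trans hy.symm) hk
  | succ k ih =>
    have h1 := ih (x := fun i => x (i + 1)) (y := fun i => y (i + 1))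
      (fun i hi => hlt _ (by omega)) hk
    rw [expansion_eq (fun i => n + 1 + x i), expansion_eq (fun i => n + 1 + y i),
      hlt 0 (by omega)]
    refine le_trans ?_ (le_abs_block_sub_block _ (expansion_nonneg _) (expansion_nonneg _)
      (expansion_le_two _) (expansion_le_two _))
    rw [pow_succ _ (k + 1), ← mul_assoc, mul_one_div]
    have hexp : 2 * (n + 1 + (y 0 : ℕ)) + 1 ≤ 2 * n + 7 := by omega
    exact div_le_div₀ (abs_nonneg _) h1 (by positivity) (pow_le_pow_right₀ (by norm_num) hexp)

lemma le_abs_codedHeight_sub (n : ℕ) {x y : ℕ → Fin 2} {k : ℕ} (hlt : ∀ i < k, x i = y i)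
    (hk : x k ≠ y k) : 1 / 10 * (1 / 36 ^ (2 * n + 7)) ^ 2 * (1 / 36 ^ (2 * n + 7)) ^ k ≤
      |codedHeight n x - codedHeight n y| := by
  have h1 := le_abs_expansion_sub n hlt hk
  have h2 := le_abs_block_sub_block (n + 3) (expansion_nonneg fun i => n + 1 + x i)
    (expansion_nonneg fun i => n + 1 + y i) (expansion_le_two _) (expansion_le_two _)
  have h3 : codedHeight n x - codedHeight n y = futureLimit n x - futureLimit n y := by
    simp only [codedHeight, height]; ring
  rw [h3, futureLimit, futureLimit]
  refine le_trans ?_ h2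
  have h4 : (1 : ℝ) / 10 * (1 / 36 ^ (2 * n + 7)) ^ 2 * (1 / 36 ^ (2 * n + 7)) ^ k =
      1 / 10 * (1 / 36 ^ (2 * n + 7)) ^ (k + 1) / 36 ^ (2 * (n + 3) + 1) := by
    rw [show 2 * (n + 3) + 1 = 2 * n + 7 by ring]
    ring
  rw [h4]
  gcongr

/-- A set of reals coded by sequences of bits has positive dimension if the distance of two of its
points is at least exponentially small in the number of common bits: reading the code as a binary
expansion is a Hölder map onto `[0, 1]`. -/
lemma dimH_range_pos {V : (ℕ → Fin 2) → ℝ} {c r : ℝ} (hc : 0 < c) (hr0 : 0 < r) (hr1 : r < 1)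
    (h : ∀ (x y : ℕ → Fin 2) (k : ℕ), (∀ i < k, x i = y i) → x k ≠ y k →
      c * r ^ k ≤ |V x - V y|) : 0 < dimH (Set.range V) := by
  have hfirst : ∀ x y : ℕ → Fin 2, x ≠ y → ∃ k, (∀ i < k, x i = y i) ∧ x k ≠ y k := by
    intro x y hxy
    have hex := Function.ne_iff.mp hxy
    classical
    exact ⟨Nat.find hex, fun i hi => not_not.mp (Nat.find_min hex hi), Nat.find_spec hex⟩
  have hinj : Function.Injective V := by
    intro x y hxy
    by_contra hne
    obtain ⟨k, h1, h2⟩ := hfirst x y hne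
    have := h x y k h1 h2
    rw [hxy, sub_self, abs_zero] at this
    have : 0 < c * r ^ k := by positivity
    linarith
  set s : ℝ := Real.log (1 / 2) / Real.log r with hs
  have hs0 : 0 < s := div_pos_of_neg_of_neg (Real.log_neg (by norm_num) (by norm_num))
    (Real.log_neg hr0 hr1)
  have hrs : r ^ s = 1 / 2 := by
    rw [Real.rpow_def_of_pos hr0, hs, mul_div_cancel₀ _ (Real.log_neg hr0 hr1).ne,
      Real.exp_log (by norm_num)]
  set f : ℝ → ℝ := fun a => Real.ofDigits (Function.invFun V a) with hf
  have hfV : ∀ x, f (V x) = Real.ofDigits x := fun x => by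
    simp only [hf, Function.leftInverse_invFun hinj x]
  have hholder : HolderOnWith (c⁻¹ ^ s).toNNReal s.toNNReal f (Set.range V) := by
    rintro _ ⟨x, rfl⟩ _ ⟨y, rfl⟩
    rw [hfV, hfV, edist_dist, edist_dist, Real.coe_toNNReal _ hs0.le,
      ENNReal.ofReal_rpow_of_nonneg dist_nonneg hs0.le]
    change _ ≤ ENNReal.ofReal _ * _
    rw [← ENNReal.ofReal_mul (by positivity)]
    apply ENNReal.ofReal_le_ofReal
    rw [Real.dist_eq, Real.dist_eq, ← Real.mul_rpow (by positivity) (abs_nonneg _)]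
    by_cases hxy : x = y
    · rw [hxy, sub_self, abs_zero]; positivity
    · obtain ⟨k, h1, h2⟩ := hfirst x y hxy
      refine (Real.abs_ofDigits_sub_ofDigits_le h1).trans ?_
      have h3 : (((2 : ℕ) : ℝ) ^ k)⁻¹ = (r ^ k) ^ s := by
        rw [← Real.rpow_natCast r k, ← Real.rpow_mul hr0.le, mul_comm, Real.rpow_mul hr0.le, hrs,
          Real.rpow_natCast]
        simp
      rw [h3]
      refine Real.rpow_le_rpow (by positivity) ?_ hs0.le
      rw [le_inv_mul_iff₀ hc]
      exact h x y k h1 h2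
  have himage : f '' Set.range V = Set.range (Real.ofDigits (b := 2)) := by
    rw [← Set.range_comp]
    congr 1
    funext x
    exact hfV x
  have hdim : (1 : ℝ≥0∞) ≤ dimH (f '' Set.range V) := by
    have h1 : Set.Icc (0 : ℝ) 1 ⊆ f '' Set.range V := by
      rw [himage, ← Set.image_univ]
      exact Real.ofDigits_SurjOn one_lt_two
    have h2 : dimH (Set.Icc (0 : ℝ) 1) = 1 := by
      rw [Real.dimH_of_nonempty_interior (by rw [interior_Icc]; exact ⟨1 / 2, by norm_num⟩)]
      simp
    exact h2 ▸ dimH_mono h1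
  have := hdim.trans (hholder.dimH_image_le (Real.toNNReal_pos.mpr hs0))
  rw [pos_iff_ne_zero]
  intro h0
  rw [h0, ENNReal.zero_div] at this
  simp at this

lemma dimH_lagrange_pos {ε : ℝ} (hε : 0 < ε) :
    0 < dimH (partBelow (lagrangeSpectrum (heckeGroup 6)) (4 / √3 + ε)) := by
  have h3 := sqrt_three_gt
  have h3' := sqrt_three_lt
  obtain ⟨m, hm⟩ := exists_pow_lt_of_lt_one (by positivity : 0 < min ε 0.04 / 4)
    (by norm_num : (1 / 3 : ℝ) < 1)
  set n := m + 1 with hn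
  have hsmall : (4 : ℝ) / 3 ^ n < min ε 0.04 := by
    have h1 : (4 : ℝ) / 3 ^ n = 4 * (1 / 3) ^ m / 3 := by
      rw [hn, pow_succ, div_pow, one_pow]; field_simp
    have h2 : (0 : ℝ) < (1 / 3) ^ m := by positivity
    linarith
  have h4 : (2.309 : ℝ) ≤ 4 / √3 := by
    rw [le_div_iff₀ (by positivity)]; linarith
  have hpow : (1 : ℝ) < 36 ^ (2 * n + 7) := one_lt_pow₀ (by norm_num) (by omega)
  have hpos := dimH_range_pos (V := codedHeight n) (c := 1 / 10 * (1 / 36 ^ (2 * n + 7)) ^ 2)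
    (r := 1 / 36 ^ (2 * n + 7)) (by positivity) (by positivity)
    (by rw [div_lt_one (by positivity)]; exact hpow)
    fun x y k hlt hk => le_abs_codedHeight_sub n hlt hk
  refine hpos.trans_le (dimH_mono ?_)
  rintro _ ⟨b, rfl⟩
  have hb := abs_le.mp (abs_codedHeight_sub_le n b)
  have h5 := min_le_left ε 0.04
  have h6 := min_le_right ε 0.04
  exact ⟨by linarith, by linarith, ofReal_codedHeight_mem b (by omega) (by linarith)⟩

end HeckeSpectra

theorem theorem1p1 (ε : ℝ) (hε : 0 < ε) :
    dimH (HeckeSpectra.partBelow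
        (HeckeSpectra.lagrangeSpectrum (HeckeSpectra.heckeGroup 6)) (4 / Real.sqrt 3 + ε)) ≤
      dimH (HeckeSpectra.partBelow
        (HeckeSpectra.markoffSpectrum (HeckeSpectra.heckeGroup 6)) (4 / Real.sqrt 3 + ε)) ∧
    0 < dimH (HeckeSpectra.partBelow
        (HeckeSpectra.lagrangeSpectrum (HeckeSpectra.heckeGroup 6)) (4 / Real.sqrt 3 + ε)) :=
  ⟨HeckeSpectra.dimH_lagrange_le_markoff _, HeckeSpectra.dimH_lagrange_pos hε⟩
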